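/- Let $n,r,N,K\in\mathbb N$, $T>0$, and let $\mathcal L(\rho)=-i[H,\rho]+\sum_{k=1}^K\bigl(L_k\rho L_k^\dagger-\tfrac12(L_k^\dagger L_k\rho+\rho L_k^\dagger L_k)\bigr)$ with $H=H^\dagger$ and $L_k$ in $\mathbb C^{n\times n}$. Let $dX_t=a(X_t,t)\,dt+\sum_{j=1}^N b_j(X_t,t)\,dW_j$ be any SDE unraveling of $\dot\rho=\mathcal L(\rho)$, i.e. $a,b_j:\mathbb C^n\times[0,T]\to\mathbb C^n$ are measurable, the $W_j$ are independent real Brownian motions, and $$a(x,t)x^\dagger+x\,a(x,t)^\dagger+\sum_{j=1}^N b_j(x,t)b_j(x,t)^\dagger=\mathcal L(xx^\dagger)\qquad\text{for all }x\in\mathbb C^n,\ t\in[0,T].$$ For $U\in\mathbb C^{n\times r}$ with $U^\dagger U=\mathrm{Id}$ put $\mathcal P_U=UU^\dagger$, $\mathcal Q_U=\mathrm{Id}-UU^\dagger$, and call a Hermitian $G\in\mathbb C^{n\times n}$ admissible at $U$ if $G=\mathcal Q_UG\mathcal P_U+\text{h.c.}$ For coefficients $(A,B)$ on $\mathbb C^d$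 let $\mathcal A^*_{A,B}f(x)=Df(x)[A(x)]+\tfrac12\sum_jD^2f(x)[B_j(x),B_j(x)]$ (real derivatives). A *low-rank dynamics obtained from the SDE by the SDLR method* is a pair $(U(t),Y_t)_{t\in[0,T]}$ with $U(t)^\dagger U(t)=\mathrm{Id}$, $$\dot U=iG(t)U,\qquad dY=A(Y,t)\,dt+\sum_{j=1}^M B_j(Y,t)\,dW_j\quad\text{in }\mathbb C^r,$$ such that for every $t$ the triple $(G(t),A(\cdot,t),(B_j(\cdot,t))_{j\le M})$ minimizes, with $f(x)=xx^\dagger$ and $X=U(t)Y_t$, $$\Bigl\|\mathbb E\bigl[(\mathcal A^*_{a_{LR},b_{LR}}f)(X)-(\mathcal A^*_{a(\cdot,t),b(\cdot,t)}f)(X)\bigr]\Bigr\|_{HS},\qquad a_{LR}(x)=iGx+UA(U^\dagger x),\quad b_{LR,j}(x)=UB_j(U^\dagger x),$$ over all admissible $G$, all $M\in\mathbb N$ and all measurable $A,B_j:\mathbb C^r\to\mathbb C^r$ with $\mathbb E[|A(Y_t)||Y_t|]<\infty$ and $\mathbb E|B_j(Y_t)|^2<\infty$. The SDE for $Y$ is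 understood in the weak sense (martingale problem for a continuous adapted process). It is assumed that $\mathbb E|Y_t|^2<\infty$, $\mathbb E[Y_tY_t^\dagger]$ is invertible, $\mathbb E[|a(U(t)Y_t,t)||Y_t|]<\infty$ and $\mathbb E|b_j(U(t)Y_t,t)|^2<\infty$ for all $t\in[0,T]$, and that $\mathbb E\int_0^T\bigl((1+|Y_t|)|A(Y_t,t)|+\sum_j|B_j(Y_t,t)|^2\bigr)dt<\infty$. **Theorem (commuting diagram).** 1. Every solution $(U,Y)$, under these assumptions with $A=U^\dagger a(U\,\cdot\,,t)$ and $B_j=U^\dagger b_j(U\,\cdot\,,t)$, of the coupled ODE–SDE system $$dY=U^\dagger a(UY,t)\,dt+\sum_{j=1}^NU^\dagger b_j(UY,t)\,dW_j,\qquad \dot U=\mathcal Q_U\Bigl(\mathbb E[a(UY,t)Y^\dagger]+\sum_{j=1}^N\mathbb E[b_j(UY,t)b_j(UY,t)^\dagger]\,U\Bigr)\mathbb E[YY^\dagger]^{-1},\qquad U^\dagger U=\mathrm{Id},$$ is a low-rank dynamics obtained by the SDLR method, with these $A,B_j$, $M=N$, and $$G=-i\,\mathcal Q_U\Bigl(\mathbb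 E[a(UY,t)(UY)^\dagger]+\sum_{j=1}^N\mathbb E[b_j(UY,t)b_j(UY,t)^\dagger]\Bigr)U\,\mathbb E[YY^\dagger]^{-1}U^\dagger+\text{h.c.}$$ 2. For every low-rank dynamics $(U,Y)$ obtained by the SDLR method, set $\sigma(t)=\mathbb E[Y_tY_t^\dagger]$ and $\rho_{LR}(t)=\mathbb E[(U(t)Y_t)(U(t)Y_t)^\dagger]$. Then $\rho_{LR}=U\sigma U^\dagger$ with $U^\dagger U=\mathrm{Id}$, $\sigma>0$, and $(U,\sigma)$ solves on $[0,T]$ the low-rank quantum master equation $$\dot\sigma=U^\dagger\mathcal L(\rho_{LR})U,\qquad \dot U=\mathcal Q_U\mathcal L(\rho_{LR})U\sigma^{-1}.$$ Moreover, $\rho_{LR}$ follows the deterministic dynamical low-rank approximation of $\dot\rho=\mathcal L(\rho)$: for every $t\in[0,T]$, $\dot\rho_{LR}(t)$ minimizes $\|\mathcal L(\rho_{LR}(t))-v\|_{HS}$ over all $v=iGU\sigma U^\dagger+U\eta U^\dagger-iU\sigma U^\dagger G$ with $\eta=\eta^\dagger\in\mathbb C^{r\times r}$ and $G$ admissible at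 $U(t)$. Both parts hold for every unraveling $(a,b_j)$ of $\mathcal L$; in particular the equations for $(U,\sigma)$ do not depend on the unraveling chosen. -/

import Mathlib

open MeasureTheory ProbabilityTheory Set Matrix
open scoped ComplexOrder

noncomputable section

namespace SDLR

/-! ### Complex matrices: Hilbert-Schmidt norm, entrywise expectation and derivative -/

/-- The Hilbert-Schmidt norm. -/
def hsNorm {m n : ℕ} (C : Matrix (Fin m) (Fin n) ℂ) : ℝ := Real.sqrt (∑ i, ∑ j, ‖C i j‖ ^ 2)

/-- The expectation of a random matrix, entry by entry. -/
def expect {Ω : Type*} {mΩ : MeasurableSpace Ω} (P : Measure Ω) {m n : ℕ}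
    (F : Ω → Matrix (Fin m) (Fin n) ℂ) : Matrix (Fin m) (Fin n) ℂ :=
  Matrix.of fun i j => ∫ ω, F ω i j ∂P

/-- `F'` is the derivative at `t` of the matrix-valued function `F` on `[0,T]`
(one-sided at the end points). -/
def HasMatDeriv {m n : ℕ} (T : ℝ) (F : ℝ → Matrix (Fin m) (Fin n) ℂ)
    (F' : Matrix (Fin m) (Fin n) ℂ) (t : ℝ) : Prop :=
  ∀ i j, HasDerivWithinAt (fun s => F s i j) (F' i j) (Icc 0 T) t

/-! ### Lindblad equation and its SDE unravelings -/

/-- The Lindblad super-operator with Hamiltonian `H` and Lindblad operators `L k`. -/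
def lindblad {n K : ℕ} (H : Matrix (Fin n) (Fin n) ℂ) (L : Fin K → Matrix (Fin n) (Fin n) ℂ)
    (ρ : Matrix (Fin n) (Fin n) ℂ) : Matrix (Fin n) (Fin n) ℂ :=
  -Complex.I • (H * ρ - ρ * H) +
    ∑ k, (L k * ρ * (L k)ᴴ - (1 / 2 : ℂ) • ((L k)ᴴ * L k * ρ + ρ * ((L k)ᴴ * L k)))

/-- The test function `f(x) = x x†`. -/
def outer {n : ℕ} (x : Fin n → ℂ) : Matrix (Fin n) (Fin n) ℂ := vecMulVec x (star x)

/-- `dX = a(X,t) dt + ∑ j, b_j(X,t) dW_j` is an SDE unraveling on `[0,T]` of `ρ' = 𝓛 ρ`: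
`a x† + x a† + ∑ j, b_j b_j† = 𝓛 (x x†)` for all `x` and all `t ∈ [0,T]`. -/
def IsUnraveling {n N : ℕ} (T : ℝ) (𝓛 : Matrix (Fin n) (Fin n) ℂ → Matrix (Fin n) (Fin n) ℂ)
    (a : (Fin n → ℂ) → ℝ → Fin n → ℂ) (b : Fin N → (Fin n → ℂ) → ℝ → Fin n → ℂ) : Prop :=
  ∀ x : Fin n → ℂ, ∀ t ∈ Icc 0 T,
    vecMulVec (a x t) (star x) + vecMulVec x (star (a x t)) + ∑ j, outer (b j x t) = 𝓛 (outer x)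

/-! ### SDEs on `ℂ^d` driven by real Brownian motions -/

/-- The generator at a fixed time of `dY = A(Y) dt + ∑ j, B_j(Y) dW_j` on `ℂ^d`, with independent
real Brownian motions `W_j`, applied to a real-smooth `f` at the point `y`:
`Df(y)[A(y)] + (1/2) ∑ j, D²f(y)[B_j(y), B_j(y)]` (real derivatives). -/
def generator {d M : ℕ} {E : Type*} [NormedAddCommGroup E] [NormedSpace ℝ E]
    (A : (Fin d → ℂ) → Fin d → ℂ) (B : Fin M → (Fin d → ℂ) → Fin d → ℂ)
    (f : (Fin d → ℂ) → E) (y : Fin d → ℂ) : E :=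
  fderiv ℝ f y (A y) + (1 / 2 : ℝ) • ∑ j, fderiv ℝ (fderiv ℝ f) y (B j y) (B j y)

/-- The generator applied to the matrix-valued test function `f(x) = x x†`, entry by entry. -/
def generatorOuter {d M : ℕ} (A : (Fin d → ℂ) → Fin d → ℂ)
    (B : Fin M → (Fin d → ℂ) → Fin d → ℂ) (y : Fin d → ℂ) : Matrix (Fin d) (Fin d) ℂ :=
  Matrix.of fun i j => generator A B (fun x => outer x i j) y

/-- `Z` is a martingale on the time interval `[0,T]`. -/
def IsMartingaleOn {Ω : Type*} {mΩ : MeasurableSpace Ω} (P : Measure Ω) (ℱ : Filtration ℝ mΩ)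
    (T : ℝ) (Z : ℝ → Ω → ℝ) : Prop :=
  (∀ t ∈ Icc 0 T, StronglyMeasurable[ℱ t] (Z t) ∧ Integrable (Z t) P) ∧
    ∀ s t, 0 ≤ s → s ≤ t → t ≤ T → P[Z t | ℱ s] =ᵐ[P] Z s

/-- `Y` is a (weak) solution on `[0,T]` of `dY = A(Y,t) dt + ∑ j, B_j(Y,t) dW_j`, in the sense of
the Stroock-Varadhan martingale problem. Because of `integrable_coeff` the local martingales of
the problem are martingales. -/
structure IsSDESolution {Ω : Type*} {mΩ : MeasurableSpace Ω} (P : Measure Ω) (ℱ : Filtration ℝ mΩ)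
    (T : ℝ) {d M : ℕ} (A : (Fin d → ℂ) → ℝ → Fin d → ℂ) (B : Fin M → (Fin d → ℂ) → ℝ → Fin d → ℂ)
    (Y : ℝ → Ω → Fin d → ℂ) : Prop where
  measurable_drift : Measurable fun p : (Fin d → ℂ) × Icc (0 : ℝ) T => A p.1 p.2
  measurable_diffusion : ∀ j, Measurable fun p : (Fin d → ℂ) × Icc (0 : ℝ) T => B j p.1 p.2
  adapted : ∀ t ∈ Icc 0 T, Measurable[ℱ t] (Y t)
  continuous_paths : ∀ ω, ContinuousOn (fun t => Y t ω) (Icc 0 T)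
  integrable_coeff : Integrable
    (fun p : ℝ × Ω => ‖A (Y p.1 p.2) p.1‖ + ∑ j, ‖B j (Y p.1 p.2) p.1‖ ^ 2)
    ((volume.restrict (Icc 0 T)).prod P)
  martingale : ∀ f : (Fin d → ℂ) → ℝ, ContDiff ℝ (⊤ : ℕ∞) f → HasCompactSupport f →
    IsMartingaleOn P ℱ T fun t ω => f (Y t ω) - f (Y 0 ω) -
      ∫ u in (0 : ℝ)..t, generator (fun y => A y u) (fun j y => B j y u) f (Y u ω)

/-! ### The stochastic dynamical low-rank approximation method -/

/-- `𝒫_U = U U†`. -/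
def projP {n r : ℕ} (U : Matrix (Fin n) (Fin r) ℂ) : Matrix (Fin n) (Fin n) ℂ := U * Uᴴ

/-- `𝒬_U = Id - U U†`. -/
def projQ {n r : ℕ} (U : Matrix (Fin n) (Fin r) ℂ) : Matrix (Fin n) (Fin n) ℂ := 1 - projP U

/-- Hermitian matrices `G` with `G = 𝒬_U G 𝒫_U + h.c.`; they parametrize the directions
`U' = i G U` tangent to the Stiefel manifold. -/
def IsGauged {n r : ℕ} (U : Matrix (Fin n) (Fin r) ℂ) (G : Matrix (Fin n) (Fin n) ℂ) : Prop :=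
  G.IsHermitian ∧ G = projQ U * G * projP U + (projQ U * G * projP U)ᴴ

/-- The drift `a_LR(x) = i G x + U A(U† x)` of `X_LR = U Y` when `U' = i G U` and
`dY = A dt + ∑ j, B_j dW_j`. -/
def driftLR {n r : ℕ} (U : Matrix (Fin n) (Fin r) ℂ) (G : Matrix (Fin n) (Fin n) ℂ)
    (A : (Fin r → ℂ) → Fin r → ℂ) (x : Fin n → ℂ) : Fin n → ℂ :=
  Complex.I • (G *ᵥ x) + U *ᵥ A (Uᴴ *ᵥ x)

/-- The diffusion coefficients `b_LR,j(x) = U B_j(U† x)` of `X_LR = U Y`. -/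
def diffusionLR {n r M : ℕ} (U : Matrix (Fin n) (Fin r) ℂ)
    (B : Fin M → (Fin r → ℂ) → Fin r → ℂ) (j : Fin M) (x : Fin n → ℂ) : Fin n → ℂ :=
  U *ᵥ B j (Uᴴ *ᵥ x)

/-- The distance `d_F(𝒜_LR μ_LR, 𝒜 μ_LR) = ‖E_{μ_LR}[𝒜_LR^* f - 𝒜^* f]‖_HS` for the single test
function `f(x) = x x†`, where `μ_LR` is the image of `θ` under `U`. -/
def distF {n r N M : ℕ} (a : (Fin n → ℂ) → Fin n → ℂ) (b : Fin N → (Fin n → ℂ) → Fin n → ℂ)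
    (U : Matrix (Fin n) (Fin r) ℂ) (θ : Measure (Fin r → ℂ)) (G : Matrix (Fin n) (Fin n) ℂ)
    (A : (Fin r → ℂ) → Fin r → ℂ) (B : Fin M → (Fin r → ℂ) → Fin r → ℂ) : ℝ :=
  hsNorm (expect (θ.map fun y => U *ᵥ y) fun x =>
    generatorOuter (driftLR U G A) (diffusionLR U B) x - generatorOuter a b x)

/-- The admissible tangent directions at `(U, θ)`: `U' = i G U` with `G` gauged, and the
Fokker-Planck operator of `dY = A dt + ∑ j, B_j dW_j`, for which the expectation of the
generator applied to `x x†` is meaningful. -/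
structure IsAdmissible {n r M : ℕ} (U : Matrix (Fin n) (Fin r) ℂ) (θ : Measure (Fin r → ℂ))
    (G : Matrix (Fin n) (Fin n) ℂ) (A : (Fin r → ℂ) → Fin r → ℂ)
    (B : Fin M → (Fin r → ℂ) → Fin r → ℂ) : Prop where
  gauged : IsGauged U G
  measurable_drift : Measurable A
  measurable_diffusion : ∀ j, Measurable (B j)
  integrable_drift : Integrable (fun y => ‖A y‖ * ‖y‖) θ
  integrable_diffusion : ∀ j, Integrable (fun y => ‖B j y‖ ^ 2) θ

/-- `(G, A, B)` solves the SDLR minimization problem at `(U, θ)` for the SDE with coefficients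
`a, b` (the number of Brownian motions of the competitors is free). -/
def IsOptimal {n r N M : ℕ} (a : (Fin n → ℂ) → Fin n → ℂ) (b : Fin N → (Fin n → ℂ) → Fin n → ℂ)
    (U : Matrix (Fin n) (Fin r) ℂ) (θ : Measure (Fin r → ℂ)) (G : Matrix (Fin n) (Fin n) ℂ)
    (A : (Fin r → ℂ) → Fin r → ℂ) (B : Fin M → (Fin r → ℂ) → Fin r → ℂ) : Prop :=
  IsAdmissible U θ G A B ∧
    ∀ (M' : ℕ) (G' : Matrix (Fin n) (Fin n) ℂ) (A' : (Fin r → ℂ) → Fin r → ℂ)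
      (B' : Fin M' → (Fin r → ℂ) → Fin r → ℂ), IsAdmissible U θ G' A' B' →
        distF a b U θ G A B ≤ distF a b U θ G' A' B'

/-- `E[Y_t Y_t†]`. -/
def secondMoment {Ω : Type*} {mΩ : MeasurableSpace Ω} (P : Measure Ω) {d : ℕ}
    (Y : ℝ → Ω → Fin d → ℂ) (t : ℝ) : Matrix (Fin d) (Fin d) ℂ :=
  expect P fun ω => outer (Y t ω)

/-- A low-rank trajectory `X_LR = U Y` on `[0,T]`: `U(t)` is in the Stiefel manifold,
`E[Y Y†]` exists and is invertible, and the expectations `E[a(UY,t) Y†]`, `E[b_j b_j†(UY,t)]`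
that occur in the SDLR method exist. -/
structure IsLowRankTrajectory {Ω : Type*} {mΩ : MeasurableSpace Ω} (P : Measure Ω) (T : ℝ)
    {n r N : ℕ} (a : (Fin n → ℂ) → ℝ → Fin n → ℂ) (b : Fin N → (Fin n → ℂ) → ℝ → Fin n → ℂ)
    (U : ℝ → Matrix (Fin n) (Fin r) ℂ) (Y : ℝ → Ω → Fin r → ℂ) : Prop where
  stiefel : ∀ t ∈ Icc 0 T, (U t)ᴴ * U t = 1
  integrable_sq : ∀ t ∈ Icc 0 T, Integrable (fun ω => ‖Y t ω‖ ^ 2) P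
  invertible : ∀ t ∈ Icc 0 T, IsUnit (secondMoment P Y t)
  integrable_drift : ∀ t ∈ Icc 0 T, Integrable (fun ω => ‖a (U t *ᵥ Y t ω) t‖ * ‖Y t ω‖) P
  integrable_diffusion : ∀ j, ∀ t ∈ Icc 0 T, Integrable (fun ω => ‖b j (U t *ᵥ Y t ω) t‖ ^ 2) P

/-- `(U, Y)` is a low-rank dynamics obtained by applying the SDLR method to
`dX = a dt + ∑ j, b_j dW_j`: it evolves by `U' = i G U`, `dY = A dt + ∑ j, B_j dW_j`, where
`(G, A, B)` solves the SDLR minimization problem at every time. -/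
structure IsSDLRDynamics {Ω : Type*} {mΩ : MeasurableSpace Ω} (P : Measure Ω) (ℱ : Filtration ℝ mΩ)
    (T : ℝ) {n r N M : ℕ}
    (a : (Fin n → ℂ) → ℝ → Fin n → ℂ) (b : Fin N → (Fin n → ℂ) → ℝ → Fin n → ℂ)
    (G : ℝ → Matrix (Fin n) (Fin n) ℂ)
    (A : (Fin r → ℂ) → ℝ → Fin r → ℂ) (B : Fin M → (Fin r → ℂ) → ℝ → Fin r → ℂ)
    (U : ℝ → Matrix (Fin n) (Fin r) ℂ) (Y : ℝ → Ω → Fin r → ℂ) : Prop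
    extends IsLowRankTrajectory P T a b U Y where
  ode : ∀ t ∈ Icc 0 T, HasMatDeriv T U (Complex.I • (G t * U t)) t
  sde : IsSDESolution P ℱ T A B Y
  integrable_growth : Integrable (fun p : ℝ × Ω => ‖A (Y p.1 p.2) p.1‖ * ‖Y p.1 p.2‖)
    ((volume.restrict (Icc 0 T)).prod P)
  optimal : ∀ t ∈ Icc 0 T,
    IsOptimal (fun x => a x t) (fun j x => b j x t) (U t) (P.map (Y t))
      (G t) (fun y => A y t) (fun j y => B j y t)

/-! ### The explicit ODE-SDE system of the SDLR method -/

/-- `A(y,t) = U†(t) a(U(t) y, t)`. -/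
def pulledDrift {n r : ℕ} (a : (Fin n → ℂ) → ℝ → Fin n → ℂ) (U : ℝ → Matrix (Fin n) (Fin r) ℂ)
    (y : Fin r → ℂ) (t : ℝ) : Fin r → ℂ :=
  (U t)ᴴ *ᵥ a (U t *ᵥ y) t

/-- `B_j(y,t) = U†(t) b_j(U(t) y, t)`. -/
def pulledDiffusion {n r N : ℕ} (b : Fin N → (Fin n → ℂ) → ℝ → Fin n → ℂ)
    (U : ℝ → Matrix (Fin n) (Fin r) ℂ) (j : Fin N) (y : Fin r → ℂ) (t : ℝ) : Fin r → ℂ :=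
  (U t)ᴴ *ᵥ b j (U t *ᵥ y) t

/-- `𝒬_U (E[a(UY,t) (UY)†] + ∑ j, E[b_j b_j†(UY,t)]) U E[YY†]⁻¹ U†`. -/
def gaugeHalf {Ω : Type*} {mΩ : MeasurableSpace Ω} (P : Measure Ω) {n r N : ℕ}
    (a : (Fin n → ℂ) → ℝ → Fin n → ℂ) (b : Fin N → (Fin n → ℂ) → ℝ → Fin n → ℂ)
    (U : ℝ → Matrix (Fin n) (Fin r) ℂ) (Y : ℝ → Ω → Fin r → ℂ) (t : ℝ) :
    Matrix (Fin n) (Fin n) ℂ :=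
  projQ (U t) *
    (expect P (fun ω => vecMulVec (a (U t *ᵥ Y t ω) t) (star (U t *ᵥ Y t ω))) +
      ∑ j, expect P fun ω => outer (b j (U t *ᵥ Y t ω) t)) *
    U t * (secondMoment P Y t)⁻¹ * (U t)ᴴ

/-- `G = (-i) 𝒬_U (…) U E[YY†]⁻¹ U† + h.c.` -/
def gauge {Ω : Type*} {mΩ : MeasurableSpace Ω} (P : Measure Ω) {n r N : ℕ}
    (a : (Fin n → ℂ) → ℝ → Fin n → ℂ) (b : Fin N → (Fin n → ℂ) → ℝ → Fin n → ℂ)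
    (U : ℝ → Matrix (Fin n) (Fin r) ℂ) (Y : ℝ → Ω → Fin r → ℂ) (t : ℝ) :
    Matrix (Fin n) (Fin n) ℂ :=
  -Complex.I • gaugeHalf P a b U Y t + (-Complex.I • gaugeHalf P a b U Y t)ᴴ

/-- `(U, Y)` solves the explicit coupled system
`dY = U† a(UY,t) dt + ∑ j, U† b_j(UY,t) dW_j`,
`U' = 𝒬_U (E[a(UY,t) Y†] + ∑ j, E[b_j b_j†(UY,t)] U) E[YY†]⁻¹`. -/
structure IsExplicitSDLR {Ω : Type*} {mΩ : MeasurableSpace Ω} (P : Measure Ω) (ℱ : Filtration ℝ mΩ)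
    (T : ℝ) {n r N : ℕ}
    (a : (Fin n → ℂ) → ℝ → Fin n → ℂ) (b : Fin N → (Fin n → ℂ) → ℝ → Fin n → ℂ)
    (U : ℝ → Matrix (Fin n) (Fin r) ℂ) (Y : ℝ → Ω → Fin r → ℂ) : Prop
    extends IsLowRankTrajectory P T a b U Y where
  ode : ∀ t ∈ Icc 0 T, HasMatDeriv T U
    (projQ (U t) *
      (expect P (fun ω => vecMulVec (a (U t *ᵥ Y t ω) t) (star (Y t ω))) +
        (∑ j, expect P fun ω => outer (b j (U t *ᵥ Y t ω) t)) * U t) *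
      (secondMoment P Y t)⁻¹) t
  sde : IsSDESolution P ℱ T (pulledDrift a U) (pulledDiffusion b U) Y
  integrable_growth : Integrable
    (fun p : ℝ × Ω => ‖pulledDrift a U (Y p.1 p.2) p.1‖ * ‖Y p.1 p.2‖)
    ((volume.restrict (Icc 0 T)).prod P)

/-! ### The deterministic low-rank quantum master equation -/

/-- The tangent directions `i G U σ U† + U η U† - i U σ U† G` at `U σ U†`, with `η` Hermitian and
`G` gauged. -/
def dlrTangent {n r : ℕ} (U : Matrix (Fin n) (Fin r) ℂ) (σ : Matrix (Fin r) (Fin r) ℂ) :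
    Set (Matrix (Fin n) (Fin n) ℂ) :=
  {v | ∃ (G : Matrix (Fin n) (Fin n) ℂ) (η : Matrix (Fin r) (Fin r) ℂ),
    IsGauged U G ∧ η.IsHermitian ∧
      v = Complex.I • (G * U * σ * Uᴴ) + U * η * Uᴴ - Complex.I • (U * σ * Uᴴ * G)}

/-- `ρ = U σ U†` follows the deterministic dynamical low-rank approximation of `ρ' = 𝓛 ρ` on
`[0,T]`: `ρ'(t)` minimizes `‖𝓛 (ρ(t)) - v‖_HS` over the tangent directions `v`. -/
def IsDLRApproximation {n r : ℕ} (T : ℝ)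
    (𝓛 : Matrix (Fin n) (Fin n) ℂ → Matrix (Fin n) (Fin n) ℂ)
    (U : ℝ → Matrix (Fin n) (Fin r) ℂ) (σ : ℝ → Matrix (Fin r) (Fin r) ℂ)
    (ρ : ℝ → Matrix (Fin n) (Fin n) ℂ) : Prop :=
  ∀ t ∈ Icc 0 T, (U t)ᴴ * U t = 1 ∧ (σ t).PosDef ∧ ρ t = U t * σ t * (U t)ᴴ ∧
    ∃ v ∈ dlrTangent (U t) (σ t), HasMatDeriv T ρ v t ∧
      ∀ w ∈ dlrTangent (U t) (σ t), hsNorm (𝓛 (ρ t) - v) ≤ hsNorm (𝓛 (ρ t) - w)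

/-- `(U, σ)` solves the low-rank quantum master equation on `[0,T]`: with `ρ_LR = U σ U†`,
`U† U = Id`, `σ > 0`,
`σ' = U† 𝓛(ρ_LR) U`, `U' = 𝒬_U 𝓛(ρ_LR) U σ⁻¹`. -/
def IsLowRankQME {n r : ℕ} (T : ℝ)
    (𝓛 : Matrix (Fin n) (Fin n) ℂ → Matrix (Fin n) (Fin n) ℂ)
    (U : ℝ → Matrix (Fin n) (Fin r) ℂ) (σ : ℝ → Matrix (Fin r) (Fin r) ℂ) : Prop :=
  ∀ t ∈ Icc 0 T, (U t)ᴴ * U t = 1 ∧ (σ t).PosDef ∧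
    HasMatDeriv T σ ((U t)ᴴ * 𝓛 (U t * σ t * (U t)ᴴ) * U t) t ∧
    HasMatDeriv T U (projQ (U t) * 𝓛 (U t * σ t * (U t)ᴴ) * U t * (σ t)⁻¹) t

end SDLR

end

namespace SDLR

/-! Write ρ = UσU† with σ = E[YY†], ℓ = 𝓛(ρ), P = UU† and Q = 1 - P. The stochastic and the
deterministic minimization turn out to be the same problem in linear algebra.

The generator of UY applied to xx† is affine in the noise data. At x = Uy it equals the tangent
vector iGUyy†U† + UηU† - iUyy†U†G, where η is the generator of Y applied to yy†
(`generatorOuter_LR`). This expression is linear in (yy†, η), so expectations pass through it. By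
the unraveling identity, the expected generator of the full SDE is ℓ, because 𝓛 is linear. Hence the
SDLR objective is ‖ℓ - v‖, with v the tangent vector built from σ, G and the expected generator η of
Y (`distF_eq`). The unraveling survives only through ℓ.

Every tangent vector satisfies QvQ = 0. Among all matrices with this property, the unique closest
one to ℓ is ℓ - QℓQ, by Pythagoras (`hsNorm_sub_sq`). It is a tangent vector because ℓ is Hermitian
and σ is invertible, and it is realized by an admissible stochastic competitor with linear drift and
no noise. So a triple is optimal exactly when its tangent vector is ℓ - QℓQ. Compressing this
identity gives η = U†ℓU and iGUσ = QℓU.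

For part 1, the coefficients U†a, U†b_j and the stated G are checked to satisfy these two equations.
For part 2, the second equation is the ODE for U after multiplication by σ⁻¹. The first becomes the
ODE for σ once σ' = η is known, which is Dynkin's formula for quadratic functions. That formula
follows from the martingale problem by truncation and dominated convergence (`bilin_moment`). It
first holds only in integrated form. This makes σ continuous, hence U†ℓU continuous, and then the
fundamental theorem of calculus gives the derivative at every t. -/

/-! ### Hilbert-Schmidt geometry. -/

lemma hsNorm_sq {m n : ℕ} (C : Matrix (Fin m) (Fin n) ℂ) :
    hsNorm C ^ 2 = ∑ i, ∑ j, ‖C i j‖ ^ 2 :=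
  Real.sq_sqrt (by positivity)

lemma hsNorm_nonneg {m n : ℕ} (C : Matrix (Fin m) (Fin n) ℂ) : 0 ≤ hsNorm C :=
  Real.sqrt_nonneg _

lemma hsNorm_neg {m n : ℕ} (C : Matrix (Fin m) (Fin n) ℂ) : hsNorm (-C) = hsNorm C := by
  simp [hsNorm]

lemma hsNorm_sub_comm {m n : ℕ} (C D : Matrix (Fin m) (Fin n) ℂ) :
    hsNorm (C - D) = hsNorm (D - C) := by
  rw [← hsNorm_neg, neg_sub]

lemma hsNorm_sq_eq_zero {m n : ℕ} {C : Matrix (Fin m) (Fin n) ℂ} (h : hsNorm C ^ 2 = 0) :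
    C = 0 := by
  rw [hsNorm_sq, Finset.sum_eq_zero_iff_of_nonneg (fun _ _ => by positivity)] at h
  ext i j
  have := h i (Finset.mem_univ _)
  rw [Finset.sum_eq_zero_iff_of_nonneg (fun _ _ => by positivity)] at this
  simpa using this j (Finset.mem_univ _)

/-- Pythagoras for the Hilbert-Schmidt inner product. -/
lemma hsNorm_add_sq {m n : ℕ} (C D : Matrix (Fin m) (Fin n) ℂ) (h : (Cᴴ * D).trace = 0) :
    hsNorm (C + D) ^ 2 = hsNorm C ^ 2 + hsNorm D ^ 2 := by
  have hs : ∑ i, ∑ j, (D i j * star (C i j)) = 0 := by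
    rw [← h, Finset.sum_comm]
    simp [Matrix.trace, Matrix.mul_apply, mul_comm]
  have hre : ∑ i, ∑ j, (D i j * star (C i j)).re = 0 := by
    simpa using congrArg Complex.re hs
  simp only [hsNorm_sq, ← Complex.normSq_eq_norm_sq, Matrix.add_apply]
  calc _ = ∑ i, ∑ j, (Complex.normSq (C i j) + Complex.normSq (D i j)
            + 2 * (D i j * star (C i j)).re) := by
        refine Finset.sum_congr rfl fun i _ => Finset.sum_congr rfl fun j _ => ?_
        rw [add_comm (C i j), Complex.normSq_add]
        simp only [Complex.star_def]
        ring
    _ = _ := by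
        simp only [Finset.sum_add_distrib, ← Finset.mul_sum, hre]
        ring

/-! ### Projections, gauged matrices, and best approximation by tangent directions. -/

section Stiefel

variable {n r : ℕ} {U : Matrix (Fin n) (Fin r) ℂ}

lemma projP_conjTranspose (U : Matrix (Fin n) (Fin r) ℂ) : (projP U)ᴴ = projP U := by
  simp [projP]

lemma projQ_conjTranspose (U : Matrix (Fin n) (Fin r) ℂ) : (projQ U)ᴴ = projQ U := by
  simp [projQ, projP_conjTranspose]

lemma projQ_mul (hU : Uᴴ * U = 1) : projQ U * U = 0 := by
  rw [projQ, projP, Matrix.sub_mul, Matrix.one_mul, Matrix.mul_assoc, hU, Matrix.mul_one, sub_self]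

lemma conjTranspose_mul_projQ (hU : Uᴴ * U = 1) : Uᴴ * projQ U = 0 := by
  rw [projQ, projP, Matrix.mul_sub, Matrix.mul_one, ← Matrix.mul_assoc, hU, Matrix.one_mul, sub_self]

lemma projQ_mul_self (hU : Uᴴ * U = 1) : projQ U * projQ U = projQ U := by
  nth_rw 1 [projQ]
  rw [projP, Matrix.sub_mul, one_mul, Matrix.mul_assoc, conjTranspose_mul_projQ hU,
    Matrix.mul_zero, sub_zero]

lemma projP_mul (hU : Uᴴ * U = 1) : projP U * U = U := by
  rw [projP, Matrix.mul_assoc, hU, Matrix.mul_one]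

lemma conjTranspose_mul_projP (hU : Uᴴ * U = 1) : Uᴴ * projP U = Uᴴ := by
  rw [projP, ← Matrix.mul_assoc, hU, Matrix.one_mul]

/-- On the range of `U` a gauged matrix acts as `𝒬_U G`. -/
lemma IsGauged.mul_eq {G : Matrix (Fin n) (Fin n) ℂ} (hU : Uᴴ * U = 1) (hG : IsGauged U G) :
    G * U = projQ U * G * U := by
  conv_lhs => rw [hG.2]
  rw [conjTranspose_mul, conjTranspose_mul, projQ_conjTranspose, Matrix.add_mul]
  simp only [Matrix.mul_assoc, projP_mul hU, projQ_mul hU, Matrix.mul_zero, add_zero]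

/-- A gauged matrix has only off-diagonal blocks for the splitting into the range of `U` and its
complement. -/
lemma IsGauged.compress {G : Matrix (Fin n) (Fin n) ℂ} (hU : Uᴴ * U = 1) (hG : IsGauged U G) :
    Uᴴ * G * U = 0 := by
  rw [Matrix.mul_assoc, hG.mul_eq hU, Matrix.mul_assoc, ← Matrix.mul_assoc,
    conjTranspose_mul_projQ hU, Matrix.zero_mul]

/-- `-i 𝒬_U C U† + h.c.` is gauged. -/
lemma isGauged_of_half (hU : Uᴴ * U = 1) (C : Matrix (Fin n) (Fin r) ℂ) :
    IsGauged U (-Complex.I • (projQ U * C * Uᴴ) + (-Complex.I • (projQ U * C * Uᴴ))ᴴ) := by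
  set D := -Complex.I • (projQ U * C * Uᴴ) with hD
  have h1 : projQ U * D * projP U = D := by
    rw [hD, Matrix.mul_smul, Matrix.smul_mul]
    congr 1
    rw [Matrix.mul_assoc, Matrix.mul_assoc (projQ U * C), conjTranspose_mul_projP hU,
      ← Matrix.mul_assoc, ← Matrix.mul_assoc, projQ_mul_self hU]
  have h2 : projQ U * Dᴴ = 0 := by
    have : D * projQ U = 0 := by
      rw [hD, Matrix.smul_mul, Matrix.mul_assoc, conjTranspose_mul_projQ hU, Matrix.mul_zero,
        smul_zero]
    have := congrArg conjTranspose this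
    simpa [conjTranspose_mul, projQ_conjTranspose] using this
  refine ⟨?_, ?_⟩
  · rw [Matrix.IsHermitian, conjTranspose_add, conjTranspose_conjTranspose, add_comm]
  · rw [Matrix.mul_add, h2, add_zero, h1]

/-- The Hermitian conjugate part ends in 𝒬_U and is lost on the range of `U`, so any velocity of the
form 𝒬_U C is generated by a gauged matrix. -/
lemma half_mul (hU : Uᴴ * U = 1) (C : Matrix (Fin n) (Fin r) ℂ) :
    Complex.I • ((-Complex.I • (projQ U * C * Uᴴ) + (-Complex.I • (projQ U * C * Uᴴ))ᴴ) * U)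
      = projQ U * C := by
  have h2 : (-Complex.I • (projQ U * C * Uᴴ))ᴴ * U = 0 := by
    rw [conjTranspose_smul, conjTranspose_mul, conjTranspose_mul, projQ_conjTranspose,
      Matrix.smul_mul, Matrix.mul_assoc, Matrix.mul_assoc, projQ_mul hU]
    simp
  rw [Matrix.add_mul, h2, add_zero, Matrix.smul_mul, Matrix.mul_assoc, hU, Matrix.mul_one, smul_smul]
  simp

/-- The tangent direction `i G U σ U† + U η U† - i U σ U† G`. -/
noncomputable def tangentVector (U : Matrix (Fin n) (Fin r) ℂ) (σ : Matrix (Fin r) (Fin r) ℂ)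
    (G : Matrix (Fin n) (Fin n) ℂ) (η : Matrix (Fin r) (Fin r) ℂ) : Matrix (Fin n) (Fin n) ℂ :=
  Complex.I • (G * U * σ * Uᴴ) + U * η * Uᴴ - Complex.I • (U * σ * Uᴴ * G)

/-- Each term starts with `U` or ends with `Uᴴ`. Neither the gauge condition nor hermiticity is
used, so the linear space cut out by this equation can replace the tangent directions when bounding
the distance from below. -/
lemma tangentVector_projQ (hU : Uᴴ * U = 1) (σ : Matrix (Fin r) (Fin r) ℂ)
    (G : Matrix (Fin n) (Fin n) ℂ) (η : Matrix (Fin r) (Fin r) ℂ) :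
    projQ U * tangentVector U σ G η * projQ U = 0 := by
  have h1 : projQ U * (U * σ * Uᴴ * G) = 0 := by
    simp only [← Matrix.mul_assoc, projQ_mul hU, Matrix.zero_mul]
  have h2 : U * η * Uᴴ * projQ U = 0 := by
    rw [Matrix.mul_assoc, conjTranspose_mul_projQ hU, Matrix.mul_zero]
  have h3 : G * U * σ * Uᴴ * projQ U = 0 := by
    rw [Matrix.mul_assoc, conjTranspose_mul_projQ hU, Matrix.mul_zero]
  rw [tangentVector, Matrix.mul_sub, Matrix.mul_smul (projQ U) _ (U * σ * Uᴴ * G), h1, smul_zero,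
    sub_zero, Matrix.mul_assoc, Matrix.add_mul, h2, Matrix.smul_mul, h3]
  simp

/-- The components of a tangent direction. -/
lemma tangentVector_compress (hU : Uᴴ * U = 1) {σ : Matrix (Fin r) (Fin r) ℂ}
    {G : Matrix (Fin n) (Fin n) ℂ} (hG : IsGauged U G) (η : Matrix (Fin r) (Fin r) ℂ) :
    Uᴴ * tangentVector U σ G η * U = η := by
  have h1 : Uᴴ * (G * U * σ * Uᴴ) = 0 := by
    simp only [← Matrix.mul_assoc, hG.compress hU, Matrix.zero_mul]
  have h2 : U * σ * Uᴴ * G * U = 0 := by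
    have : U * σ * Uᴴ * G * U = U * σ * (Uᴴ * G * U) := by simp only [Matrix.mul_assoc]
    rw [this, hG.compress hU, Matrix.mul_zero]
  have h3 : Uᴴ * (U * η * Uᴴ) * U = η := by
    have : Uᴴ * (U * η * Uᴴ) * U = (Uᴴ * U) * η * (Uᴴ * U) := by simp only [Matrix.mul_assoc]
    rw [this, hU, Matrix.one_mul, Matrix.mul_one]
  rw [tangentVector, Matrix.mul_sub, Matrix.mul_add, Matrix.mul_smul, h1, Matrix.sub_mul, smul_zero, zero_add, h3,
    Matrix.mul_smul, Matrix.smul_mul, Matrix.mul_assoc Uᴴ, h2]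
  simp

/-- This block isolates the velocity of `U`; together with `tangentVector_compress` it recovers η
and, for invertible σ, iGU from the tangent vector. -/
lemma tangentVector_projQ_mul (hU : Uᴴ * U = 1) {σ : Matrix (Fin r) (Fin r) ℂ}
    {G : Matrix (Fin n) (Fin n) ℂ} (hG : IsGauged U G) (η : Matrix (Fin r) (Fin r) ℂ) :
    projQ U * tangentVector U σ G η * U = Complex.I • (G * U) * σ := by
  have h1 : projQ U * (U * σ * Uᴴ * G) = 0 := by
    simp only [← Matrix.mul_assoc, projQ_mul hU, Matrix.zero_mul]
  have h2 : projQ U * (U * η * Uᴴ) = 0 := by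
    simp only [← Matrix.mul_assoc, projQ_mul hU, Matrix.zero_mul]
  rw [tangentVector, Matrix.mul_sub, Matrix.mul_smul (projQ U) _ (U * σ * Uᴴ * G), h1, smul_zero,
    sub_zero, Matrix.mul_add, h2, add_zero, Matrix.mul_smul, Matrix.smul_mul, Matrix.smul_mul]
  congr 1
  rw [Matrix.mul_assoc, Matrix.mul_assoc _ Uᴴ, hU, Matrix.mul_one, ← Matrix.mul_assoc,
    ← Matrix.mul_assoc, ← hG.mul_eq hU]

/-- A tangent direction with the optimal components is `ℓ - 𝒬_U ℓ 𝒬_U`. -/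
lemma tangentVector_eq {σ : Matrix (Fin r) (Fin r) ℂ} (hσ : σ.IsHermitian)
    {l : Matrix (Fin n) (Fin n) ℂ} (hl : l.IsHermitian)
    {G : Matrix (Fin n) (Fin n) ℂ} (hG : IsGauged U G)
    (hGU : Complex.I • (G * U) * σ = projQ U * l * U) :
    tangentVector U σ G (Uᴴ * l * U) = l - projQ U * l * projQ U := by
  have h1 : Complex.I • (G * U * σ * Uᴴ) = projQ U * l * projP U := by
    rw [← Matrix.smul_mul, ← Matrix.smul_mul, hGU, projP, ← Matrix.mul_assoc]
  have h2 : -(Complex.I • (U * σ * Uᴴ * G)) = projP U * l * projQ U := by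
    have := congrArg conjTranspose h1
    simpa [conjTranspose_mul, conjTranspose_smul, hG.1.eq, hσ.eq, hl.eq, projP_conjTranspose,
      projQ_conjTranspose, Matrix.mul_assoc] using this
  have h3 : U * (Uᴴ * l * U) * Uᴴ = projP U * l * projP U := by
    simp only [projP, Matrix.mul_assoc]
  -- The three terms are the blocks 𝒬ℓ𝒫, 𝒫ℓ𝒬 and 𝒫ℓ𝒫, that is, all of ℓ except 𝒬ℓ𝒬.
  rw [tangentVector, sub_eq_add_neg, h1, h2, h3, projQ]
  noncomm_ring

/-- Invertibility of σ allows iGUσ = 𝒬_U ℓ U to be solved for iGU; the solution 𝒬_U ℓ U σ⁻¹ has the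
form produced by `half_mul`. -/
lemma exists_tangentVector_eq (hU : Uᴴ * U = 1) {σ : Matrix (Fin r) (Fin r) ℂ} (hσ : σ.IsHermitian)
    (hσu : IsUnit σ) {l : Matrix (Fin n) (Fin n) ℂ} (hl : l.IsHermitian) :
    ∃ G, IsGauged U G ∧ tangentVector U σ G (Uᴴ * l * U) = l - projQ U * l * projQ U := by
  refine ⟨_, isGauged_of_half hU (l * U * σ⁻¹), tangentVector_eq hσ hl
    (isGauged_of_half hU (l * U * σ⁻¹)) ?_⟩
  have hdet := (Matrix.isUnit_iff_isUnit_det σ).1 hσu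
  rw [half_mul hU, Matrix.mul_assoc, Matrix.nonsing_inv_mul_cancel_right _ _ hdet,
    Matrix.mul_assoc]

/-- Pythagoras for the distance from `ℓ` to the tangent directions. -/
lemma hsNorm_sub_sq (hU : Uᴴ * U = 1) (l : Matrix (Fin n) (Fin n) ℂ)
    {v : Matrix (Fin n) (Fin n) ℂ} (hv : projQ U * v * projQ U = 0) :
    hsNorm (l - v) ^ 2 =
      hsNorm (projQ U * l * projQ U) ^ 2 + hsNorm (l - projQ U * l * projQ U - v) ^ 2 := by
  set Q := projQ U
  have hQ : Q * Q = Q := projQ_mul_self hU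
  have hw : Q * (l - Q * l * Q - v) * Q = 0 := by
    have : Q * (Q * l * Q) * Q = Q * l * Q := by
      rw [← Matrix.mul_assoc, ← Matrix.mul_assoc, hQ, Matrix.mul_assoc _ Q Q, hQ]
    rw [Matrix.mul_sub, Matrix.sub_mul, hv, Matrix.mul_sub, Matrix.sub_mul, this]
    simp
  rw [← hsNorm_add_sq]
  · congr 2
    abel
  · rw [conjTranspose_mul, conjTranspose_mul, projQ_conjTranspose U]
    change (Q * (lᴴ * Q) * (l - Q * l * Q - v)).trace = 0
    -- Idempotence duplicates `Q`, so that cyclicity of the trace can move one copy to the far right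
    -- and create the vanishing factor Q(ℓ - QℓQ - v)Q.
    rw [Matrix.trace_mul_comm, ← hQ, Matrix.trace_mul_comm]
    have : Q * Q * (lᴴ * (Q * Q)) * (l - Q * Q * l * (Q * Q) - v)
        = Q * (Q * lᴴ * (Q * (l - Q * l * Q - v))) := by
      simp only [hQ, ← Matrix.mul_assoc]
    rw [this, Matrix.trace_mul_comm, Matrix.mul_assoc, hw, Matrix.mul_zero, Matrix.trace_zero]

/-- `ℓ - 𝒬_U ℓ 𝒬_U` is a best approximation of `ℓ`. -/
lemma hsNorm_projQ_le (hU : Uᴴ * U = 1) (l : Matrix (Fin n) (Fin n) ℂ)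
    {v : Matrix (Fin n) (Fin n) ℂ} (hv : projQ U * v * projQ U = 0) :
    hsNorm (l - (l - projQ U * l * projQ U)) ≤ hsNorm (l - v) := by
  rw [sub_sub_cancel]
  refine le_of_sq_le_sq ?_ (hsNorm_nonneg _)
  rw [hsNorm_sub_sq hU l hv]
  nlinarith [sq_nonneg (hsNorm (l - projQ U * l * projQ U - v))]

/-- The best approximation of `ℓ` is unique. -/
lemma eq_of_hsNorm_le (hU : Uᴴ * U = 1) (l : Matrix (Fin n) (Fin n) ℂ)
    {v : Matrix (Fin n) (Fin n) ℂ} (hv : projQ U * v * projQ U = 0)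
    (hle : hsNorm (l - v) ≤ hsNorm (l - (l - projQ U * l * projQ U))) :
    v = l - projQ U * l * projQ U := by
  rw [sub_sub_cancel] at hle
  have h1 := pow_le_pow_left₀ (hsNorm_nonneg _) hle 2
  rw [hsNorm_sub_sq hU l hv] at h1
  have h2 : hsNorm (l - projQ U * l * projQ U - v) ^ 2 = 0 :=
    le_antisymm (by linarith) (sq_nonneg _)
  exact (sub_eq_zero.1 (hsNorm_sq_eq_zero h2)).symm

end Stiefel

/-! ### The Lindblad super-operator -/

/-- The Lindblad super-operator as a linear map. -/
noncomputable def lindbladLin {n K : ℕ} (H : Matrix (Fin n) (Fin n) ℂ) (L : Fin K → Matrix (Fin n) (Fin n) ℂ) :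
    Matrix (Fin n) (Fin n) ℂ →ₗ[ℂ] Matrix (Fin n) (Fin n) ℂ where
  toFun := lindblad H L
  map_add' x y := by
    simp only [lindblad, mul_add, add_mul, Finset.sum_add_distrib, Finset.sum_sub_distrib,
      smul_add, smul_sub]
    abel
  map_smul' c x := by
    simp only [lindblad, Matrix.mul_smul, Matrix.smul_mul, RingHom.id_apply, smul_add, smul_sub,
      Finset.smul_sum, smul_comm c]

/-- Hermiticity of ℓ makes its two off-diagonal blocks adjoint to each other, which is what lets one
gauged `G` match both. -/
lemma lindblad_isHermitian {n K : ℕ} {H : Matrix (Fin n) (Fin n) ℂ} (hH : H.IsHermitian)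
    (L : Fin K → Matrix (Fin n) (Fin n) ℂ) {ρ : Matrix (Fin n) (Fin n) ℂ} (hρ : ρ.IsHermitian) :
    (lindblad H L ρ).IsHermitian := by
  rw [Matrix.IsHermitian, lindblad, conjTranspose_add, conjTranspose_sum]
  congr 1
  · simp [conjTranspose_mul, hH.eq, hρ.eq, sub_eq_neg_add, add_comm]
  · refine Finset.sum_congr rfl fun k _ => ?_
    simp [conjTranspose_mul, hρ.eq, Matrix.mul_assoc, add_comm]

/-! ### The generator on quadratic functions -/

section Quadratic

variable {d M : ℕ} {F : Type*} [NormedAddCommGroup F] [NormedSpace ℝ F]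

/-- `β` is not assumed symmetric, so the derivative is its symmetrization. -/
lemma fderiv_bilin_self {E : Type*} [NormedAddCommGroup E] [NormedSpace ℝ E]
    (β : E →L[ℝ] E →L[ℝ] F) : fderiv ℝ (fun y => β y y) = fun y => (β + β.flip) y := by
  ext y v
  have h : HasFDerivAt (fun y => β y y) _ y :=
    β.hasFDerivAt_of_bilinear (hasFDerivAt_id y) (hasFDerivAt_id y)
  rw [h.fderiv]
  simp

lemma fderiv_fderiv_bilin_self {E : Type*} [NormedAddCommGroup E] [NormedSpace ℝ E]
    (β : E →L[ℝ] E →L[ℝ] F) (y : E) :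
    fderiv ℝ (fderiv ℝ (fun y => β y y)) y = β + β.flip := by
  rw [fderiv_bilin_self]
  exact (β + β.flip).fderiv

/-- The generator applied to `y ↦ β(y, y)`. -/
lemma generator_bilin_self (β : (Fin d → ℂ) →L[ℝ] (Fin d → ℂ) →L[ℝ] F)
    (A : (Fin d → ℂ) → Fin d → ℂ) (B : Fin M → (Fin d → ℂ) → Fin d → ℂ) (y : Fin d → ℂ) :
    generator A B (fun y => β y y) y = β y (A y) + β (A y) y + ∑ j, β (B j y) (B j y) := by
  rw [generator, fderiv_fderiv_bilin_self, fderiv_bilin_self, Finset.smul_sum]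
  congr 1
  refine Finset.sum_congr rfl fun j _ => ?_
  simp only [_root_.add_apply, ContinuousLinearMap.flip_apply]
  -- The second derivative on the diagonal is 2β(b,b), which cancels the factor 1/2 of the
  -- generator.
  rw [← two_smul ℝ, smul_smul]
  norm_num

/-- The real bilinear map `(x, y) ↦ x_i conj(y_j)`. -/
noncomputable def outerBilin {d : ℕ} (i j : Fin d) : (Fin d → ℂ) →L[ℝ] (Fin d → ℂ) →L[ℝ] ℂ :=
  (ContinuousLinearMap.mul ℝ ℂ).bilinearComp (ContinuousLinearMap.proj i)
    ((Complex.conjCLE : ℂ →L[ℝ] ℂ).comp (ContinuousLinearMap.proj j))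

lemma outerBilin_apply {d : ℕ} (i j : Fin d) (x y : Fin d → ℂ) :
    outerBilin i j x y = x i * star (y j) := rfl

/-- Each entry of xx† is a real-bilinear form on the diagonal. The result is the left side of the
unraveling identity. -/
lemma generatorOuter_eq (A : (Fin d → ℂ) → Fin d → ℂ) (B : Fin M → (Fin d → ℂ) → Fin d → ℂ)
    (y : Fin d → ℂ) : generatorOuter A B y =
      vecMulVec (A y) (star y) + vecMulVec y (star (A y)) + ∑ j, outer (B j y) := by
  ext i j
  have h := generator_bilin_self (outerBilin i j) A B y
  simp only [outerBilin_apply] at h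
  simp only [generatorOuter, outer, Matrix.of_apply, vecMulVec_apply, Pi.star_apply,
    Matrix.add_apply, Matrix.sum_apply]
  rw [h]
  ring

end Quadratic

lemma conjTranspose_outer {d : ℕ} (y : Fin d → ℂ) : (outer y)ᴴ = outer y := by
  rw [outer, conjTranspose_vecMulVec, star_star]

lemma outer_mulVec {m d : ℕ} (C : Matrix (Fin m) (Fin d) ℂ) (y : Fin d → ℂ) :
    outer (C *ᵥ y) = C * outer y * Cᴴ := by
  rw [outer, outer, star_mulVec, Matrix.mul_vecMulVec, vecMulVec_mul]

lemma generatorOuter_isHermitian {d M : ℕ} (A : (Fin d → ℂ) → Fin d → ℂ)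
    (B : Fin M → (Fin d → ℂ) → Fin d → ℂ) (y : Fin d → ℂ) :
    (generatorOuter A B y).IsHermitian := by
  rw [Matrix.IsHermitian, generatorOuter_eq]
  simp [conjTranspose_vecMulVec, conjTranspose_outer, conjTranspose_sum, add_comm]

/-- The generator of `X_LR = U Y` applied to `x x†`. -/
lemma generatorOuter_LR {n r M : ℕ} {U : Matrix (Fin n) (Fin r) ℂ} (hU : Uᴴ * U = 1)
    {G : Matrix (Fin n) (Fin n) ℂ} (hG : G.IsHermitian)
    (A : (Fin r → ℂ) → Fin r → ℂ) (B : Fin M → (Fin r → ℂ) → Fin r → ℂ) (y : Fin r → ℂ) :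
    generatorOuter (driftLR U G A) (diffusionLR U B) (U *ᵥ y) =
      tangentVector U (outer y) G (generatorOuter A B y) := by
  have hy : Uᴴ *ᵥ (U *ᵥ y) = y := by rw [mulVec_mulVec, hU, one_mulVec]
  rw [generatorOuter_eq, generatorOuter_eq, tangentVector]
  simp only [driftLR, diffusionLR, hy, outer_mulVec, star_add, star_smul, add_vecMulVec,
    vecMulVec_add, smul_vecMulVec, vecMulVec_smul, Matrix.mul_add, Matrix.add_mul,
    Matrix.mul_sum, Matrix.sum_mul, star_mulVec, mulVec_mulVec, hG.eq, conjTranspose_mul]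
  simp only [outer, Matrix.mul_vecMulVec, vecMulVec_mul, vecMul_vecMul]
  simp only [Complex.star_def, Complex.conj_I, neg_smul]
  abel

/-! ### Expectations of random matrices -/

section Expect

variable {Ω : Type*} {mΩ : MeasurableSpace Ω} {P : Measure Ω} {m n p q : ℕ}

/-- All entries are integrable. -/
def EntryIntegrable (P : Measure Ω) (F : Ω → Matrix (Fin m) (Fin n) ℂ) : Prop :=
  ∀ i j, Integrable (fun ω => F ω i j) P

lemma EntryIntegrable.add {F G : Ω → Matrix (Fin m) (Fin n) ℂ} (hF : EntryIntegrable P F)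
    (hG : EntryIntegrable P G) : EntryIntegrable P fun ω => F ω + G ω :=
  fun i j => (hF i j).add (hG i j)

lemma EntryIntegrable.sub {F G : Ω → Matrix (Fin m) (Fin n) ℂ} (hF : EntryIntegrable P F)
    (hG : EntryIntegrable P G) : EntryIntegrable P fun ω => F ω - G ω :=
  fun i j => (hF i j).sub (hG i j)

lemma EntryIntegrable.sum {ι : Type*} (s : Finset ι) {F : ι → Ω → Matrix (Fin m) (Fin n) ℂ}
    (hF : ∀ k, EntryIntegrable P (F k)) : EntryIntegrable P fun ω => ∑ k ∈ s, F k ω := by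
  intro i j
  simp only [Matrix.sum_apply]
  exact integrable_finsetSum _ fun k _ => hF k i j

lemma EntryIntegrable.conjTranspose {F : Ω → Matrix (Fin m) (Fin n) ℂ}
    (hF : EntryIntegrable P F) : EntryIntegrable P fun ω => (F ω)ᴴ :=
  fun i j => (Complex.conjCLE : ℂ →L[ℝ] ℂ).integrable_comp (hF j i)

lemma linearMap_apply_entry (Λ : Matrix (Fin m) (Fin n) ℂ →ₗ[ℂ] Matrix (Fin p) (Fin q) ℂ)
    (C : Matrix (Fin m) (Fin n) ℂ) (i : Fin p) (j : Fin q) :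
    Λ C i j = ∑ k, ∑ l, C k l * Λ (Matrix.single k l 1) i j := by
  conv_lhs => rw [matrix_eq_sum_single C]
  simp only [map_sum, Matrix.sum_apply]
  refine Finset.sum_congr rfl fun k _ => Finset.sum_congr rfl fun l _ => ?_
  rw [show Matrix.single k l (C k l) = C k l • Matrix.single k l (1 : ℂ) by simp, map_smul]
  rfl

lemma EntryIntegrable.map {F : Ω → Matrix (Fin m) (Fin n) ℂ} (hF : EntryIntegrable P F)
    (Λ : Matrix (Fin m) (Fin n) ℂ →ₗ[ℂ] Matrix (Fin p) (Fin q) ℂ) :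
    EntryIntegrable P fun ω => Λ (F ω) := by
  intro i j
  simp only [linearMap_apply_entry Λ (F _)]
  exact integrable_finsetSum _ fun k _ => integrable_finsetSum _ fun l _ => (hF k l).mul_const _

/-- Entries of the image are finite linear combinations of entries of `F`, so entrywise
integrability is enough. -/
lemma expect_map {F : Ω → Matrix (Fin m) (Fin n) ℂ} (hF : EntryIntegrable P F)
    (Λ : Matrix (Fin m) (Fin n) ℂ →ₗ[ℂ] Matrix (Fin p) (Fin q) ℂ) :
    expect P (fun ω => Λ (F ω)) = Λ (expect P F) := by
  ext i j
  rw [linearMap_apply_entry Λ]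
  simp only [expect, Matrix.of_apply, linearMap_apply_entry Λ (F _)]
  rw [integral_finsetSum _ fun k _ => integrable_finsetSum _ fun l _ => (hF k l).mul_const _]
  refine Finset.sum_congr rfl fun k _ => ?_
  rw [integral_finsetSum _ fun l _ => (hF k l).mul_const _]
  exact Finset.sum_congr rfl fun l _ => integral_mul_const _ _

lemma expect_add {F G : Ω → Matrix (Fin m) (Fin n) ℂ} (hF : EntryIntegrable P F)
    (hG : EntryIntegrable P G) : expect P (fun ω => F ω + G ω) = expect P F + expect P G := by
  ext i j
  exact integral_add (hF i j) (hG i j)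

lemma expect_sub {F G : Ω → Matrix (Fin m) (Fin n) ℂ} (hF : EntryIntegrable P F)
    (hG : EntryIntegrable P G) : expect P (fun ω => F ω - G ω) = expect P F - expect P G := by
  ext i j
  exact integral_sub (hF i j) (hG i j)

lemma expect_sum {ι : Type*} (s : Finset ι) {F : ι → Ω → Matrix (Fin m) (Fin n) ℂ}
    (hF : ∀ k, EntryIntegrable P (F k)) :
    expect P (fun ω => ∑ k ∈ s, F k ω) = ∑ k ∈ s, expect P (F k) := by
  ext i j
  simp only [expect, Matrix.sum_apply, Matrix.of_apply]
  exact integral_finsetSum _ fun k _ => hF k i j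

lemma expect_conjTranspose (F : Ω → Matrix (Fin m) (Fin n) ℂ) :
    expect P (fun ω => (F ω)ᴴ) = (expect P F)ᴴ := by
  ext i j
  exact integral_conj

lemma expect_isHermitian {F : Ω → Matrix (Fin m) (Fin m) ℂ} (hF : ∀ ω, (F ω).IsHermitian) :
    (expect P F).IsHermitian := by
  rw [Matrix.IsHermitian, ← expect_conjTranspose]
  simp only [(hF _).eq]

lemma expect_map_measure {Ω' : Type*} {mΩ' : MeasurableSpace Ω'} {X : Ω → Ω'}
    (hX : AEMeasurable X P) {F : Ω' → Matrix (Fin m) (Fin n) ℂ}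
    (hF : ∀ i j, AEStronglyMeasurable (fun x => F x i j) (P.map X)) :
    expect (P.map X) F = expect P fun ω => F (X ω) := by
  ext i j
  exact integral_map hX (hF i j)

/-- Multiplication from both sides. -/
def sandwich (C : Matrix (Fin p) (Fin m) ℂ) (D : Matrix (Fin n) (Fin q) ℂ) :
    Matrix (Fin m) (Fin n) ℂ →ₗ[ℂ] Matrix (Fin p) (Fin q) ℂ where
  toFun X := C * X * D
  map_add' X Y := by rw [Matrix.mul_add, Matrix.add_mul]
  map_smul' c X := by rw [Matrix.mul_smul, Matrix.smul_mul, RingHom.id_apply]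

lemma sandwich_apply (C : Matrix (Fin p) (Fin m) ℂ) (D : Matrix (Fin n) (Fin q) ℂ)
    (X : Matrix (Fin m) (Fin n) ℂ) : sandwich C D X = C * X * D := rfl

lemma tangentVector_eq_sandwich (U : Matrix (Fin n) (Fin m) ℂ) (G : Matrix (Fin n) (Fin n) ℂ)
    (σ η : Matrix (Fin m) (Fin m) ℂ) : tangentVector U σ G η =
      sandwich (Complex.I • (G * U)) Uᴴ σ + sandwich U Uᴴ η
        - sandwich U (Complex.I • (Uᴴ * G)) σ := by
  simp only [tangentVector, sandwich_apply, Matrix.smul_mul, Matrix.mul_smul, Matrix.mul_assoc]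

lemma EntryIntegrable.tangentVector {S E : Ω → Matrix (Fin m) (Fin m) ℂ}
    (hS : EntryIntegrable P S) (hE : EntryIntegrable P E) (U : Matrix (Fin n) (Fin m) ℂ)
    (G : Matrix (Fin n) (Fin n) ℂ) :
    EntryIntegrable P fun ω => tangentVector U (S ω) G (E ω) := by
  simp only [tangentVector_eq_sandwich]
  exact ((hS.map _).add (hE.map _)).sub (hS.map _)

lemma expect_tangentVector {S E : Ω → Matrix (Fin m) (Fin m) ℂ}
    (hS : EntryIntegrable P S) (hE : EntryIntegrable P E) (U : Matrix (Fin n) (Fin m) ℂ)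
    (G : Matrix (Fin n) (Fin n) ℂ) :
    expect P (fun ω => tangentVector U (S ω) G (E ω)) =
      tangentVector U (expect P S) G (expect P E) := by
  simp only [tangentVector_eq_sandwich]
  rw [expect_sub ((hS.map _).add (hE.map _)) (hS.map _), expect_add (hS.map _) (hE.map _)]
  simp only [expect_map hS, expect_map hE]

lemma entryIntegrable_vecMulVec {u : Ω → Fin m → ℂ} {v : Ω → Fin n → ℂ} (hu : Measurable u)
    (hv : Measurable v) (h : Integrable (fun ω => ‖u ω‖ * ‖v ω‖) P) :
    EntryIntegrable P fun ω => vecMulVec (u ω) (star (v ω)) := by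
  intro i j
  have hui : Measurable fun ω => u ω i := (measurable_pi_apply i).comp hu
  have hvj : Measurable fun ω => star (v ω j) :=
    continuous_star.measurable.comp ((measurable_pi_apply j).comp hv)
  refine h.mono' (hui.mul hvj).aestronglyMeasurable (ae_of_all _ fun ω => ?_)
  simp only [vecMulVec_apply, Pi.star_apply, norm_mul, norm_star]
  gcongr <;> exact norm_le_pi_norm _ _

lemma entryIntegrable_outer {u : Ω → Fin m → ℂ} (hu : Measurable u)
    (h : Integrable (fun ω => ‖u ω‖ ^ 2) P) : EntryIntegrable P fun ω => outer (u ω) :=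
  entryIntegrable_vecMulVec hu hu (by simpa only [sq] using h)

lemma entryIntegrable_generatorOuter {M : ℕ} {A : (Fin m → ℂ) → Fin m → ℂ}
    {B : Fin M → (Fin m → ℂ) → Fin m → ℂ} {y : Ω → Fin m → ℂ} (hy : Measurable y)
    (hA : Measurable A) (hB : ∀ j, Measurable (B j))
    (hAi : Integrable (fun ω => ‖A (y ω)‖ * ‖y ω‖) P)
    (hBi : ∀ j, Integrable (fun ω => ‖B j (y ω)‖ ^ 2) P) :
    EntryIntegrable P fun ω => generatorOuter A B (y ω) := by
  simp only [generatorOuter_eq]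
  refine ((entryIntegrable_vecMulVec (hA.comp hy) hy hAi).add
    (entryIntegrable_vecMulVec hy (hA.comp hy) ?_)).add
    (EntryIntegrable.sum _ fun j => entryIntegrable_outer ((hB j).comp hy) (hBi j))
  simpa only [mul_comm, Function.comp_apply] using hAi

end Expect

/-! ### The minimization problem -/

section Optimal

variable {n r N M : ℕ} {a : (Fin n → ℂ) → Fin n → ℂ} {b : Fin N → (Fin n → ℂ) → Fin n → ℂ}
  {U : Matrix (Fin n) (Fin r) ℂ} {θ : Measure (Fin r → ℂ)} {G : Matrix (Fin n) (Fin n) ℂ}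
  {A : (Fin r → ℂ) → Fin r → ℂ} {B : Fin M → (Fin r → ℂ) → Fin r → ℂ}
  {Λ : Matrix (Fin n) (Fin n) ℂ →ₗ[ℂ] Matrix (Fin n) (Fin n) ℂ}

lemma IsAdmissible.entryIntegrable (h : IsAdmissible U θ G A B) :
    EntryIntegrable θ fun y => generatorOuter A B y :=
  entryIntegrable_generatorOuter measurable_id h.measurable_drift h.measurable_diffusion
    h.integrable_drift h.integrable_diffusion

/-- For a measurable embedding, integrals against the image measure can be pulled back without any
measurability of the integrand; thus nothing is needed from `a` and `b` in `distF_eq`. -/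
lemma measurableEmbedding_mulVec (hU : Uᴴ * U = 1) :
    MeasurableEmbedding fun y : Fin r → ℂ => U *ᵥ y := by
  refine Topology.IsClosedEmbedding.measurableEmbedding ?_
  have hc : ∀ {k l : ℕ} (C : Matrix (Fin k) (Fin l) ℂ), Continuous fun y => C *ᵥ y :=
    fun C => Continuous.matrix_mulVec continuous_const continuous_id
  refine Function.LeftInverse.isClosedEmbedding (f := fun x => Uᴴ *ᵥ x) (fun y => ?_) (hc _) (hc _)
  simp only [mulVec_mulVec, hU, one_mulVec]

/-- The reduction of the stochastic problem to the deterministic one: the objective depends on the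
law and on `A`, `B` only through E[YY†] and the expected generator, and on `a`, `b` only through
`Λ`. -/
lemma distF_eq (hU : Uᴴ * U = 1) (hθ : Integrable (fun y => ‖y‖ ^ 2) θ)
    (hΛ : ∀ x, generatorOuter a b x = Λ (outer x)) (h : IsAdmissible U θ G A B) :
    distF a b U θ G A B = hsNorm (Λ (U * expect θ outer * Uᴴ) -
      tangentVector U (expect θ outer) G (expect θ (generatorOuter A B))) := by
  have hout : EntryIntegrable θ outer := entryIntegrable_outer measurable_id hθ
  have hmap : ∀ F : (Fin n → ℂ) → Matrix (Fin n) (Fin n) ℂ,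
      expect (θ.map fun y => U *ᵥ y) F = expect θ fun y => F (U *ᵥ y) := fun F => by
    ext i j
    exact (measurableEmbedding_mulVec hU).integral_map _
  rw [distF, hmap, hsNorm_sub_comm]
  simp only [generatorOuter_LR hU h.gauged.1, hΛ, outer_mulVec, ← sandwich_apply U Uᴴ]
  rw [expect_sub (hout.tangentVector h.entryIntegrable U G) ((hout.map (sandwich U Uᴴ)).map Λ),
    expect_tangentVector hout h.entryIntegrable]
  congr 2
  exact (expect_map (hout.map (sandwich U Uᴴ)) Λ).trans
    (congrArg Λ (expect_map hout (sandwich U Uᴴ)))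

lemma isHermitian_expect_outer (θ : Measure (Fin r → ℂ)) :
    (expect θ (outer : (Fin r → ℂ) → _)).IsHermitian :=
  expect_isHermitian conjTranspose_outer

/-- An admissible triple that realizes the orthogonal projection of `ℓ` is optimal. -/
lemma IsAdmissible.isOptimal (hU : Uᴴ * U = 1) (hθ : Integrable (fun y => ‖y‖ ^ 2) θ)
    (hΛ : ∀ x, generatorOuter a b x = Λ (outer x)) (h : IsAdmissible U θ G A B)
    (heq : tangentVector U (expect θ outer) G (expect θ (generatorOuter A B)) =
      Λ (U * expect θ outer * Uᴴ) - projQ U * Λ (U * expect θ outer * Uᴴ) * projQ U) :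
    IsOptimal a b U θ G A B := by
  refine ⟨h, fun M' G' A' B' h' => ?_⟩
  rw [distF_eq hU hθ hΛ h, distF_eq hU hθ hΛ h', heq]
  exact hsNorm_projQ_le hU _ (tangentVector_projQ hU _ _ _)

/-- An optimal triple realizes the orthogonal projection of `ℓ` on the tangent directions. -/
lemma IsOptimal.tangentVector_eq (hU : Uᴴ * U = 1) (hθ : Integrable (fun y => ‖y‖ ^ 2) θ)
    (hσ : IsUnit (expect θ (outer : (Fin r → ℂ) → _)))
    (hΛ : ∀ x, generatorOuter a b x = Λ (outer x))
    (hl : (Λ (U * expect θ outer * Uᴴ)).IsHermitian) (h : IsOptimal a b U θ G A B) :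
    tangentVector U (expect θ outer) G (expect θ (generatorOuter A B)) =
      Λ (U * expect θ outer * Uᴴ) - projQ U * Λ (U * expect θ outer * Uᴴ) * projQ U := by
  -- By uniqueness of the best approximation, it remains to exhibit one admissible competitor that
  -- attains it.
  refine eq_of_hsNorm_le hU _ (tangentVector_projQ hU _ _ _) ?_
  set σ := expect θ (outer : (Fin r → ℂ) → _) with hσdef
  have hσh : σ.IsHermitian := isHermitian_expect_outer θ
  have hdet := (Matrix.isUnit_iff_isUnit_det σ).1 hσ
  set l := Λ (U * σ * Uᴴ) with hldef
  obtain ⟨G', hG', hG'eq⟩ := exists_tangentVector_eq hU hσh hσ hl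
  set η := Uᴴ * l * U
  have hη : ηᴴ = η := by
    simp only [η, conjTranspose_mul, conjTranspose_conjTranspose, hl.eq, Matrix.mul_assoc]
  -- The noiseless linear drift y ↦ Cy has expected generator Cσ + σC†. This choice makes both terms
  -- η/2, since η and σ are Hermitian.
  set C := (1 / 2 : ℂ) • (η * σ⁻¹) with hC
  have hout : EntryIntegrable θ outer := entryIntegrable_outer measurable_id hθ
  have hcont : Continuous fun y : Fin r → ℂ => C *ᵥ y :=
    Continuous.matrix_mulVec continuous_const continuous_id
  obtain ⟨c, hc⟩ : ∃ c, ∀ y, ‖C *ᵥ y‖ ≤ c * ‖y‖ :=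
    ⟨_, (LinearMap.toContinuousLinearMap C.mulVecLin).le_opNorm⟩
  have hadm : IsAdmissible U θ G' (fun y => C *ᵥ y) (fun j : Fin 0 => Fin.elim0 j) := by
    refine ⟨hG', hcont.measurable, fun j => Fin.elim0 j, ?_, fun j => Fin.elim0 j⟩
    refine (hθ.const_mul c).mono' (by fun_prop) (ae_of_all _ fun y => ?_)
    rw [norm_mul, norm_norm, norm_norm, sq, ← mul_assoc]
    exact mul_le_mul_of_nonneg_right (hc y) (norm_nonneg _)
  have hgen : expect θ (generatorOuter (fun y => C *ᵥ y) (fun j : Fin 0 => Fin.elim0 j)) = η := by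
    have h1 : ∀ y, generatorOuter (fun y => C *ᵥ y) (fun j : Fin 0 => Fin.elim0 j) y =
        sandwich C 1 (outer y) + sandwich 1 Cᴴ (outer y) := fun y => by
      simp only [generatorOuter_eq, sandwich_apply, Matrix.mul_one, one_mulVec, outer,
        Matrix.mul_vecMulVec, vecMulVec_mul, star_mulVec, Finset.univ_eq_empty, Finset.sum_empty,
        add_zero]
    have h2 : C * σ = (1 / 2 : ℂ) • η := by
      rw [hC, Matrix.smul_mul, Matrix.nonsing_inv_mul_cancel_right _ _ hdet]
    have h3 : σ * Cᴴ = (1 / 2 : ℂ) • η := by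
      have := congrArg conjTranspose h2
      rw [conjTranspose_mul, hσh.eq, conjTranspose_smul (1 / 2 : ℂ) η, hη] at this
      rw [this]
      simp
    rw [funext h1, expect_add (hout.map _) (hout.map _), expect_map hout, expect_map hout,
      sandwich_apply, sandwich_apply, Matrix.mul_one, Matrix.one_mul, ← hσdef, h2, h3, ← add_smul]
    norm_num
  have := h.2 0 G' _ _ hadm
  rwa [distF_eq hU hθ hΛ h.1, distF_eq hU hθ hΛ hadm, hgen, ← hσdef, ← hldef, hG'eq] at this

end Optimal

open Filter Topology

/-! ### Truncated quadratic functions -/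

lemma exists_bound_fderiv {E F : Type*} [NormedAddCommGroup E] [NormedSpace ℝ E]
    [NormedAddCommGroup F] [NormedSpace ℝ F] {h : E → F} (hh : ContDiff ℝ 1 h)
    (hc : HasCompactSupport h) : ∃ C : ℝ, ∀ y, ‖fderiv ℝ h y‖ ≤ C :=
  (hh.continuous_fderiv (by simp)).bounded_above_of_compact_support (hc.fderiv ℝ)

lemma exists_bound_fderiv_fderiv {E F : Type*} [NormedAddCommGroup E] [NormedSpace ℝ E]
    [NormedAddCommGroup F] [NormedSpace ℝ F] {g : E → F} (hg : ContDiff ℝ (⊤ : ℕ∞) g)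
    (hc : HasCompactSupport g) : ∃ C : ℝ, ∀ y, ‖fderiv ℝ (fderiv ℝ g) y‖ ≤ C :=
  exists_bound_fderiv (hg.fderiv_right (by norm_cast)) (hc.fderiv ℝ)

/-- A test function that is quadratic near the origin. -/
lemma exists_local_truncation {E : Type*} [NormedAddCommGroup E] [NormedSpace ℝ E]
    [FiniteDimensional ℝ E] (β : E →L[ℝ] E →L[ℝ] ℝ) :
    ∃ C : ℝ, 0 ≤ C ∧ ∃ g : E → ℝ, ContDiff ℝ (⊤ : ℕ∞) g ∧ HasCompactSupport g ∧
      (∀ y, ‖g y‖ ≤ C * ‖y‖ ^ 2) ∧ (∀ y, ‖fderiv ℝ g y‖ ≤ C * ‖y‖) ∧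
      (∀ y, ‖fderiv ℝ (fderiv ℝ g) y‖ ≤ C) ∧
      ∀ y, ‖y‖ < 1 → g =ᶠ[𝓝 y] fun y => β y y := by
  -- Inner radius 1 makes `g` agree with the quadratic form on the unit ball; the outer radius 2 is
  -- arbitrary.
  obtain ⟨ψ, hψ⟩ : ∃ ψ : ContDiffBump (0 : E), ψ.rIn = 1 := ⟨⟨1, 2, one_pos, one_lt_two⟩, rfl⟩
  set g : E → ℝ := fun y => ψ y * β y y with hg
  have hβ : ContDiff ℝ (⊤ : ℕ∞) fun y => β y y := by fun_prop
  have hgs : ContDiff ℝ (⊤ : ℕ∞) g := ψ.contDiff.mul hβ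
  have hgc : HasCompactSupport g := ψ.hasCompactSupport.mul_right
  have hloc : ∀ y : E, ‖y‖ < 1 → g =ᶠ[𝓝 y] fun y => β y y := fun y hy => by
    have hy' : y ∈ Metric.ball (0 : E) ψ.rIn := by simpa [hψ] using hy
    filter_upwards [ψ.eventuallyEq_one_of_mem_ball hy'] with z hz
    simp [hg, hz]
  have hg1 : ContDiff ℝ (⊤ : ℕ∞) (fderiv ℝ g) := hgs.fderiv_right (by norm_cast)
  obtain ⟨C₂, hC₂⟩ := exists_bound_fderiv_fderiv hgs hgc
  have hC₂0 : 0 ≤ C₂ := (norm_nonneg (fderiv ℝ (fderiv ℝ g) 0)).trans (hC₂ 0)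
  -- The gradient vanishes at the origin, so a bounded second derivative gives linear growth of the
  -- gradient by the mean value inequality.
  have hD0 : fderiv ℝ g 0 = 0 := by
    rw [(hloc 0 (by simp)).fderiv_eq, fderiv_bilin_self]
    simp
  have hD1 : ∀ y, ‖fderiv ℝ g y‖ ≤ C₂ * ‖y‖ := fun y => by
    have := Convex.norm_image_sub_le_of_norm_fderiv_le (𝕜 := ℝ) (f := fderiv ℝ g) (s := univ)
      (fun x _ => hg1.differentiable (by simp) x) (fun x _ => hC₂ x) convex_univ
      (mem_univ (0 : E)) (mem_univ y)
    simpa [hD0] using this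
  have hg0 : ∀ y, ‖g y‖ ≤ ‖β‖ * ‖y‖ ^ 2 := fun y => by
    rw [hg, norm_mul, Real.norm_of_nonneg ψ.nonneg]
    calc ψ y * ‖β y y‖ ≤ 1 * ‖β y y‖ := by gcongr; exact ψ.le_one
      _ ≤ ‖β‖ * ‖y‖ ^ 2 := by
        rw [one_mul, sq, ← mul_assoc]
        exact β.le_opNorm₂ y y
  refine ⟨max ‖β‖ C₂, hC₂0.trans (le_max_right _ _), g, hgs, hgc, fun y => (hg0 y).trans ?_,
    fun y => (hD1 y).trans ?_, fun y => (hC₂ y).trans (le_max_right _ _), hloc⟩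
  · gcongr
    exact le_max_left _ _
  · gcongr
    exact le_max_right _ _

/-- Quadratic functions are limits of test functions, with uniform quadratic bounds. -/
lemma exists_truncation {E : Type*} [NormedAddCommGroup E] [NormedSpace ℝ E]
    [FiniteDimensional ℝ E] (β : E →L[ℝ] E →L[ℝ] ℝ) :
    ∃ C : ℝ, 0 ≤ C ∧ ∃ f : ℕ → E → ℝ, ∀ k, ContDiff ℝ (⊤ : ℕ∞) (f k) ∧ HasCompactSupport (f k) ∧
      (∀ y, ‖f k y‖ ≤ C * ‖y‖ ^ 2) ∧ (∀ y, ‖fderiv ℝ (f k) y‖ ≤ C * ‖y‖) ∧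
      (∀ y, ‖fderiv ℝ (fderiv ℝ (f k)) y‖ ≤ C) ∧
      ∀ y, ‖y‖ < k + 1 → f k =ᶠ[𝓝 y] fun y => β y y := by
  obtain ⟨C, hC, g, hgs, hgc, hg0, hD1, hD2, hloc⟩ := exists_local_truncation β
  have hg1 : ContDiff ℝ (⊤ : ℕ∞) (fderiv ℝ g) := hgs.fderiv_right (by norm_cast)
  -- The scaling R² g(y/R) preserves quadratic forms and all three bounds with the same `C`, while
  -- enlarging the region of agreement. R = k + 1 avoids R = 0.
  refine ⟨C, hC, fun k y => ((k : ℝ) + 1) ^ 2 * g (((k : ℝ) + 1)⁻¹ • y), fun k => ?_⟩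
  set R : ℝ := (k : ℝ) + 1 with hR
  have hR0 : 0 < R := by positivity
  have e1 : fderiv ℝ (fun y => R ^ 2 * g (R⁻¹ • y)) = fun y => R • fderiv ℝ g (R⁻¹ • y) := by
    ext1 y
    have hd : DifferentiableAt ℝ (fun y => g (R⁻¹ • y)) y :=
      (hgs.differentiable (by simp)).comp (differentiable_id.const_smul _) y
    rw [fderiv_const_mul hd, fderiv_comp_smul, smul_smul]
    congr 1
    field_simp
  have e2 : ∀ y, fderiv ℝ (fun y => R • fderiv ℝ g (R⁻¹ • y)) y
      = fderiv ℝ (fderiv ℝ g) (R⁻¹ • y) := fun y => by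
    have hd : DifferentiableAt ℝ (fun y => fderiv ℝ g (R⁻¹ • y)) y :=
      (hg1.differentiable (by simp)).comp (differentiable_id.const_smul _) y
    rw [fderiv_fun_const_smul hd, fderiv_comp_smul, smul_smul, mul_inv_cancel₀ hR0.ne', one_smul]
  have hnorm : ∀ y : E, ‖R⁻¹ • y‖ = R⁻¹ * ‖y‖ := fun y => by
    rw [norm_smul, norm_inv, Real.norm_of_nonneg hR0.le]
  refine ⟨contDiff_const.mul (hgs.comp (contDiff_id.const_smul _)), ?_, fun y => ?_, fun y => ?_,
    fun y => ?_, fun y hy => ?_⟩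
  · exact (hgc.comp_homeomorph (Homeomorph.smulOfNeZero R⁻¹ (inv_ne_zero hR0.ne'))).mul_left
  · rw [norm_mul, Real.norm_of_nonneg (by positivity)]
    calc R ^ 2 * ‖g (R⁻¹ • y)‖ ≤ R ^ 2 * (C * ‖R⁻¹ • y‖ ^ 2) := by gcongr; exact hg0 _
      _ = C * ‖y‖ ^ 2 := by rw [hnorm]; field_simp
  · rw [e1, norm_smul, Real.norm_of_nonneg hR0.le]
    calc R * ‖fderiv ℝ g (R⁻¹ • y)‖ ≤ R * (C * ‖R⁻¹ • y‖) := by gcongr; exact hD1 _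
      _ = C * ‖y‖ := by rw [hnorm]; field_simp
  · rw [e1, e2]
    exact hD2 _
  · have hy1 : ‖R⁻¹ • y‖ < 1 := by
      rw [hnorm, inv_mul_lt_one₀ hR0]
      exact hy
    have hc : Tendsto (fun y : E => R⁻¹ • y) (𝓝 y) (𝓝 (R⁻¹ • y)) :=
      (continuous_const_smul R⁻¹).continuousAt
    filter_upwards [hc.eventually (hloc _ hy1)] with z hz
    rw [hz]
    simp only [map_smul, _root_.smul_apply, smul_eq_mul]
    change R ^ 2 * _ = _
    field_simp

/-- The bound is shaped to match the two integrability hypotheses on the coefficients; the isolated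
`‖A y‖` is slack. -/
lemma norm_generator_le {d M : ℕ} (A : (Fin d → ℂ) → Fin d → ℂ)
    (B : Fin M → (Fin d → ℂ) → Fin d → ℂ) {f : (Fin d → ℂ) → ℝ} {y : Fin d → ℂ} {C : ℝ}
    (h1 : ‖fderiv ℝ f y‖ ≤ C * ‖y‖) (h2 : ‖fderiv ℝ (fderiv ℝ f) y‖ ≤ C) :
    ‖generator A B f y‖ ≤ C * (‖A y‖ * ‖y‖ + (‖A y‖ + ∑ j, ‖B j y‖ ^ 2)) := by
  have hC : 0 ≤ C := (norm_nonneg (fderiv ℝ (fderiv ℝ f) y)).trans h2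
  have hA : ‖fderiv ℝ f y (A y)‖ ≤ C * (‖A y‖ * ‖y‖) := by
    calc _ ≤ ‖fderiv ℝ f y‖ * ‖A y‖ := ContinuousLinearMap.le_opNorm _ _
      _ ≤ C * ‖y‖ * ‖A y‖ := by gcongr
      _ = _ := by ring
  have hB : ‖∑ j, fderiv ℝ (fderiv ℝ f) y (B j y) (B j y)‖ ≤ C * ∑ j, ‖B j y‖ ^ 2 := by
    rw [Finset.mul_sum]
    refine norm_sum_le_of_le _ fun j _ => ?_
    calc _ ≤ ‖fderiv ℝ (fderiv ℝ f) y‖ * ‖B j y‖ * ‖B j y‖ :=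
        ContinuousLinearMap.le_opNorm₂ _ _ _
      _ ≤ C * ‖B j y‖ * ‖B j y‖ := by gcongr
      _ = _ := by ring
  have hA0 : 0 ≤ C * ‖A y‖ := by positivity
  have hB0 : 0 ≤ C * ∑ j, ‖B j y‖ ^ 2 := by positivity
  calc ‖generator A B f y‖ ≤ ‖fderiv ℝ f y (A y)‖ +
        ‖(1 / 2 : ℝ) • ∑ j, fderiv ℝ (fderiv ℝ f) y (B j y) (B j y)‖ := norm_add_le _ _
    _ ≤ C * (‖A y‖ * ‖y‖) + C * ∑ j, ‖B j y‖ ^ 2 := by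
        refine add_le_add hA ?_
        rw [norm_smul]
        norm_num
        rw [Real.norm_eq_abs] at hB
        linarith
    _ ≤ _ := by linarith

lemma generator_congr {d M : ℕ} {E : Type*} [NormedAddCommGroup E] [NormedSpace ℝ E]
    (A : (Fin d → ℂ) → Fin d → ℂ) (B : Fin M → (Fin d → ℂ) → Fin d → ℂ)
    {f g : (Fin d → ℂ) → E} {y : Fin d → ℂ} (h : f =ᶠ[𝓝 y] g) :
    generator A B f y = generator A B g y := by
  rw [generator, generator, h.fderiv_eq, h.fderiv.fderiv_eq]

/-! ### Second moments of solutions of the martingale problem -/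

namespace IsSDESolution

variable {Ω : Type*} {mΩ : MeasurableSpace Ω} {P : Measure Ω} {ℱ : Filtration ℝ mΩ}
  {T : ℝ} {d M : ℕ} {A : (Fin d → ℂ) → ℝ → Fin d → ℂ}
  {B : Fin M → (Fin d → ℂ) → ℝ → Fin d → ℂ} {Y : ℝ → Ω → Fin d → ℂ}

lemma measurable (h : IsSDESolution P ℱ T A B Y) {t : ℝ} (ht : t ∈ Icc 0 T) : Measurable (Y t) :=
  (h.adapted t ht).mono (ℱ.le t) le_rfl

/-- The process is controlled only on [0,T], so time is clamped there; path continuity together with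
measurability at each time yields joint measurability. -/
lemma measurable_extend (h : IsSDESolution P ℱ T A B Y) (hT : 0 ≤ T) :
    Measurable fun p : ℝ × Ω => Y (projIcc 0 T hT p.1) p.2 := by
  refine measurable_uncurry_of_continuous_of_measurable
    (u := fun t ω => Y (projIcc 0 T hT t) ω) (fun ω => ?_) fun t => h.measurable (projIcc 0 T hT t).2
  exact (h.continuous_paths ω).comp_continuous
    (continuous_subtype_val.comp continuous_projIcc) fun t => (projIcc 0 T hT t).2

lemma ae_mem (P : Measure Ω) [SFinite P] (T : ℝ) :
    ∀ᵐ p ∂((volume.restrict (Icc (0 : ℝ) T)).prod P), p.1 ∈ Icc 0 T :=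
  Measure.quasiMeasurePreserving_fst.ae (ae_restrict_mem measurableSet_Icc)

lemma aestronglyMeasurable_generator [SFinite P] (h : IsSDESolution P ℱ T A B Y) (hT : 0 ≤ T)
    {f : (Fin d → ℂ) → ℝ} (hf : ContDiff ℝ (⊤ : ℕ∞) f) :
    AEStronglyMeasurable (fun p : ℝ × Ω =>
      generator (fun y => A y p.1) (fun j y => B j y p.1) f (Y p.1 p.2))
      ((volume.restrict (Icc 0 T)).prod P) := by
  have hf1 : ContDiff ℝ (⊤ : ℕ∞) (fderiv ℝ f) := hf.fderiv_right (by norm_cast)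
  have hf2 : Continuous (fderiv ℝ (fderiv ℝ f)) := hf1.continuous_fderiv (by simp)
  have hY := h.measurable_extend hT
  have hτ : Measurable fun p : ℝ × Ω => projIcc 0 T hT p.1 :=
    continuous_projIcc.measurable.comp measurable_fst
  have hA := h.measurable_drift.comp (hY.prodMk hτ)
  have hB := fun j => (h.measurable_diffusion j).comp (hY.prodMk hτ)
  have c1 : Continuous fun q : (Fin d → ℂ) × (Fin d → ℂ) => fderiv ℝ f q.1 q.2 :=
    (hf1.continuous.comp continuous_fst).clm_apply continuous_snd
  have c2 : Continuous fun q : (Fin d → ℂ) × (Fin d → ℂ) =>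
      fderiv ℝ (fderiv ℝ f) q.1 q.2 q.2 :=
    ((hf2.comp continuous_fst).clm_apply continuous_snd).clm_apply continuous_snd
  have hm : Measurable fun p : ℝ × Ω => generator (fun y => A y (projIcc 0 T hT p.1))
      (fun j y => B j y (projIcc 0 T hT p.1)) f (Y (projIcc 0 T hT p.1) p.2) := by
    unfold generator
    refine (c1.measurable.comp (hY.prodMk hA)).add (Measurable.fun_const_smul ?_ _)
    exact Finset.measurable_sum _ fun j _ => c2.measurable.comp (hY.prodMk (hB j))
  refine hm.aestronglyMeasurable.congr ?_
  filter_upwards [ae_mem P T] with p hp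
  rw [projIcc_of_mem hT hp]

lemma integral_martingale [IsProbabilityMeasure P] {Z : ℝ → Ω → ℝ} (h : IsMartingaleOn P ℱ T Z)
    {t : ℝ} (ht : t ∈ Icc 0 T) : ∫ ω, Z t ω ∂P = ∫ ω, Z 0 ω ∂P := by
  rw [← integral_condExp (ℱ.le 0) (f := Z t)]
  exact integral_congr_ae (h.2 0 t le_rfl ht.1 ht.2)

/-- Dynkin's formula for a test function. -/
lemma dynkin [IsProbabilityMeasure P] (h : IsSDESolution P ℱ T A B Y)
    {f : (Fin d → ℂ) → ℝ} (hf : ContDiff ℝ (⊤ : ℕ∞) f) (hfc : HasCompactSupport f)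
    (hint : Integrable (fun p : ℝ × Ω =>
      generator (fun y => A y p.1) (fun j y => B j y p.1) f (Y p.1 p.2))
      ((volume.restrict (Icc 0 T)).prod P)) {t : ℝ} (ht : t ∈ Icc 0 T) :
    ∫ ω, f (Y t ω) ∂P - ∫ ω, f (Y 0 ω) ∂P =
      ∫ p : ℝ × Ω, generator (fun y => A y p.1) (fun j y => B j y p.1) f (Y p.1 p.2)
        ∂((volume.restrict (Ioc 0 t)).prod P) := by
  have hm := h.martingale f hf hfc
  have h0 : (0 : ℝ) ∈ Icc 0 T := ⟨le_rfl, ht.1.trans ht.2⟩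
  obtain ⟨C, hC⟩ := hf.continuous.bounded_above_of_compact_support hfc
  have hfi : ∀ s ∈ Icc 0 T, Integrable (fun ω => f (Y s ω)) P := fun s hs =>
    Integrable.of_bound (hf.continuous.measurable.comp (h.measurable hs)).aestronglyMeasurable C
      (ae_of_all _ fun ω => hC _)
  have hZ := integral_martingale hm ht
  have hI : Integrable (fun ω => ∫ u in (0 : ℝ)..t,
      generator (fun y => A y u) (fun j y => B j y u) f (Y u ω)) P := by
    -- The time integral is the difference of the bounded increment of `f` and the martingale value,
    -- both integrable.
    have := ((hfi t ht).sub (hfi 0 h0)).sub (hm.1 t ht).2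
    refine this.congr (ae_of_all _ fun ω => ?_)
    simp
  have hd : Integrable (fun ω => f (Y t ω) - f (Y 0 ω)) P := (hfi t ht).sub (hfi 0 h0)
  rw [integral_sub hd hI, integral_sub (hfi t ht) (hfi 0 h0)] at hZ
  simp only [sub_self, intervalIntegral.integral_same, integral_zero] at hZ
  rw [sub_eq_zero.1 hZ, integral_prod_symm]
  · simp only [intervalIntegral.integral_of_le ht.1]
  · refine hint.mono_measure ?_
    exact Measure.prod_mono (Measure.restrict_mono
      (Ioc_subset_Icc_self.trans (Icc_subset_Icc le_rfl ht.2)) le_rfl) le_rfl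

/-- The evolution of the second moments. -/
theorem bilin_moment [IsProbabilityMeasure P] (h : IsSDESolution P ℱ T A B Y) (hT : 0 ≤ T)
    (hgrowth : Integrable (fun p : ℝ × Ω => ‖A (Y p.1 p.2) p.1‖ * ‖Y p.1 p.2‖)
      ((volume.restrict (Icc 0 T)).prod P))
    (hsq : ∀ t ∈ Icc 0 T, Integrable (fun ω => ‖Y t ω‖ ^ 2) P)
    (β : (Fin d → ℂ) →L[ℝ] (Fin d → ℂ) →L[ℝ] ℝ) :
    IntegrableOn (fun u => ∫ ω, generator (fun y => A y u) (fun j y => B j y u)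
      (fun y => β y y) (Y u ω) ∂P) (Icc 0 T) ∧
    ∀ t ∈ Icc 0 T, ∫ ω, β (Y t ω) (Y t ω) ∂P - ∫ ω, β (Y 0 ω) (Y 0 ω) ∂P =
      ∫ u in (0 : ℝ)..t, ∫ ω, generator (fun y => A y u) (fun j y => B j y u)
        (fun y => β y y) (Y u ω) ∂P := by
  -- A quadratic form is not compactly supported; the truncations are test functions that eventually
  -- coincide with it near any given point.
  obtain ⟨C, hC, f, hf⟩ := exists_truncation β
  have hev : ∀ y : Fin d → ℂ, ∀ᶠ k : ℕ in atTop, f k =ᶠ[𝓝 y] fun y => β y y := fun y => by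
    obtain ⟨k₀, hk₀⟩ := exists_nat_gt ‖y‖
    filter_upwards [eventually_ge_atTop k₀] with k hk
    refine (hf k).2.2.2.2.2 y (hk₀.trans_le ?_)
    have : (k₀ : ℝ) ≤ k := by exact_mod_cast hk
    linarith
  have hbound := (hgrowth.add h.integrable_coeff).const_mul C
  have hle : ∀ k (p : ℝ × Ω), ‖generator (fun y => A y p.1) (fun j y => B j y p.1) (f k)
      (Y p.1 p.2)‖ ≤ C * (‖A (Y p.1 p.2) p.1‖ * ‖Y p.1 p.2‖ +
        (‖A (Y p.1 p.2) p.1‖ + ∑ j, ‖B j (Y p.1 p.2) p.1‖ ^ 2)) := fun k p =>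
    norm_generator_le _ _ ((hf k).2.2.2.1 _) ((hf k).2.2.2.2.1 _)
  have hβ : ContDiff ℝ (⊤ : ℕ∞) fun y => β y y := by fun_prop
  have hint : ∀ k, Integrable (fun p : ℝ × Ω => generator (fun y => A y p.1)
      (fun j y => B j y p.1) (f k) (Y p.1 p.2)) ((volume.restrict (Icc 0 T)).prod P) := fun k =>
    hbound.mono' (h.aestronglyMeasurable_generator hT (hf k).1) (ae_of_all _ (hle k))
  -- At each point the generator of the quadratic form equals that of some truncation, so the same
  -- dominating function applies.
  have hintβ : Integrable (fun p : ℝ × Ω => generator (fun y => A y p.1)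
      (fun j y => B j y p.1) (fun y => β y y) (Y p.1 p.2))
      ((volume.restrict (Icc 0 T)).prod P) := by
    refine hbound.mono' (h.aestronglyMeasurable_generator hT hβ) (ae_of_all _ fun p => ?_)
    obtain ⟨k, hk⟩ := (hev (Y p.1 p.2)).exists
    rw [← generator_congr _ _ hk]
    exact hle k p
  refine ⟨hintβ.integral_prod_left, fun t ht => ?_⟩
  have hmono : (volume.restrict (Ioc 0 t)).prod P ≤ (volume.restrict (Icc 0 T)).prod P :=
    Measure.prod_mono (Measure.restrict_mono
      (Ioc_subset_Icc_self.trans (Icc_subset_Icc le_rfl ht.2)) le_rfl) le_rfl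
  have hlim : ∀ s ∈ Icc 0 T, Tendsto (fun k => ∫ ω, f k (Y s ω) ∂P) atTop
      (𝓝 (∫ ω, β (Y s ω) (Y s ω) ∂P)) := fun s hs => by
    refine tendsto_integral_of_dominated_convergence _ (fun k =>
      ((hf k).1.continuous.measurable.comp (h.measurable hs)).aestronglyMeasurable)
      ((hsq s hs).const_mul C) (fun k => ae_of_all _ fun ω => (hf k).2.2.1 _)
      (ae_of_all _ fun ω => ?_)
    refine tendsto_const_nhds.congr' ?_
    filter_upwards [hev (Y s ω)] with k hk
    exact hk.eq_of_nhds.symm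
  have hlimgen : Tendsto (fun k => ∫ p : ℝ × Ω, generator (fun y => A y p.1)
      (fun j y => B j y p.1) (f k) (Y p.1 p.2) ∂((volume.restrict (Ioc 0 t)).prod P)) atTop
      (𝓝 (∫ p : ℝ × Ω, generator (fun y => A y p.1) (fun j y => B j y p.1)
        (fun y => β y y) (Y p.1 p.2) ∂((volume.restrict (Ioc 0 t)).prod P))) := by
    refine tendsto_integral_of_dominated_convergence _
      (fun k => ((hint k).mono_measure hmono).aestronglyMeasurable) (hbound.mono_measure hmono)
      (fun k => ae_of_all _ (hle k)) (ae_of_all _ fun p => ?_)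
    refine tendsto_const_nhds.congr' ?_
    filter_upwards [hev (Y p.1 p.2)] with k hk
    exact (generator_congr _ _ hk).symm
  have h0 : (0 : ℝ) ∈ Icc 0 T := ⟨le_rfl, hT⟩
  have := tendsto_nhds_unique ((hlim t ht).sub (hlim 0 h0))
    (hlimgen.congr fun k => (h.dynkin (hf k).1 (hf k).2.1 (hint k) ht).symm)
  rw [this, integral_prod _ (hintβ.mono_measure hmono), intervalIntegral.integral_of_le ht.1]

end IsSDESolution

/-! ### Calculus on `[0,T]` -/

section Calculus

variable {T : ℝ}

/-- First half of the bootstrap: mere integrability of the integrand already gives continuity. -/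
lemma continuousOn_of_integral {φ ψ : ℝ → ℝ} (hT : 0 ≤ T) (hψ : IntegrableOn ψ (Icc 0 T))
    (h : ∀ t ∈ Icc 0 T, φ t - φ 0 = ∫ u in (0 : ℝ)..t, ψ u) : ContinuousOn φ (Icc 0 T) := by
  have h1 : ContinuousOn (fun t => ∫ u in (0 : ℝ)..t, ψ u) (Icc 0 T) := by
    have := intervalIntegral.continuousOn_primitive_interval (f := ψ) (μ := volume) (a := 0)
      (b := T) (by rwa [uIcc_of_le hT])
    rwa [uIcc_of_le hT] at this
  refine (h1.add (continuousOn_const (c := φ 0))).congr fun t ht => ?_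
  simp [← h t ht]

lemma hasDerivWithinAt_of_integral {φ ψ : ℝ → ℝ} (hT : 0 ≤ T) (hψ : ContinuousOn ψ (Icc 0 T))
    (h : ∀ t ∈ Icc 0 T, φ t - φ 0 = ∫ u in (0 : ℝ)..t, ψ u) {t : ℝ} (ht : t ∈ Icc 0 T) :
    HasDerivWithinAt φ (ψ t) (Icc 0 T) t := by
  -- Extending ψ by its end values makes the two-sided fundamental theorem available at 0 and T as
  -- well.
  have hc : Continuous fun s : ℝ => ψ (projIcc 0 T hT s) :=
    hψ.comp_continuous (continuous_subtype_val.comp continuous_projIcc)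
      fun s => (projIcc 0 T hT s).2
  have hd := ((hc.integral_hasStrictDerivAt 0 t).hasDerivAt.add_const (φ 0)).hasDerivWithinAt
    (s := Icc 0 T)
  rw [projIcc_of_mem hT ht] at hd
  refine hd.congr_of_mem (fun s hs => ?_) ht
  rw [← sub_eq_iff_eq_add, h s hs]
  refine intervalIntegral.integral_congr fun u hu => ?_
  rw [uIcc_of_le hs.1] at hu
  simp only [projIcc_of_mem hT (show u ∈ Icc 0 T from ⟨hu.1, hu.2.trans hs.2⟩)]

lemma hasDerivWithinAt_of_re_im {z : ℝ → ℂ} {w : ℂ} {s : Set ℝ} {t : ℝ}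
    (hre : HasDerivWithinAt (fun t => (z t).re) w.re s t)
    (him : HasDerivWithinAt (fun t => (z t).im) w.im s t) : HasDerivWithinAt z w s t := by
  have := hre.ofReal_comp.add (him.ofReal_comp.mul_const Complex.I)
  rw [Complex.re_add_im] at this
  refine this.congr_of_eventuallyEq (Filter.Eventually.of_forall fun s => ?_) ?_ <;>
  exact (Complex.re_add_im _).symm

lemma continuousOn_of_re_im {z : ℝ → ℂ} {s : Set ℝ} (hre : ContinuousOn (fun t => (z t).re) s)
    (him : ContinuousOn (fun t => (z t).im) s) : ContinuousOn z s := by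
  have := (Complex.continuous_ofReal.comp_continuousOn hre).add
    ((Complex.continuous_ofReal.comp_continuousOn him).mul (continuousOn_const (c := Complex.I)))
  exact this.congr fun t _ => (Complex.re_add_im _).symm

variable {m n p : ℕ}

lemma HasMatDeriv.continuousOn {F F' : ℝ → Matrix (Fin m) (Fin n) ℂ}
    (h : ∀ t ∈ Icc 0 T, HasMatDeriv T F (F' t) t) : ContinuousOn F (Icc 0 T) :=
  continuousOn_pi.2 fun i => continuousOn_pi.2 fun j => fun t ht =>
    (h t ht i j).continuousWithinAt

lemma HasMatDeriv.mul {F : ℝ → Matrix (Fin m) (Fin n) ℂ} {F' : Matrix (Fin m) (Fin n) ℂ}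
    {E : ℝ → Matrix (Fin n) (Fin p) ℂ} {E' : Matrix (Fin n) (Fin p) ℂ} {t : ℝ}
    (hF : HasMatDeriv T F F' t) (hE : HasMatDeriv T E E' t) :
    HasMatDeriv T (fun s => F s * E s) (F' * E t + F t * E') t := by
  intro i j
  simp only [Matrix.mul_apply, Matrix.add_apply, ← Finset.sum_add_distrib]
  exact HasDerivWithinAt.fun_sum fun k _ => (hF i k).mul (hE k j)

lemma HasMatDeriv.conjTranspose {F : ℝ → Matrix (Fin m) (Fin n) ℂ}
    {F' : Matrix (Fin m) (Fin n) ℂ} {t : ℝ} (hF : HasMatDeriv T F F' t) :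
    HasMatDeriv T (fun s => (F s)ᴴ) F'ᴴ t :=
  fun i j => (hF j i).star

lemma HasMatDeriv.congr {F E : ℝ → Matrix (Fin m) (Fin n) ℂ} {F' : Matrix (Fin m) (Fin n) ℂ}
    {t : ℝ} (hF : HasMatDeriv T F F' t) (ht : t ∈ Icc 0 T) (h : ∀ s ∈ Icc 0 T, E s = F s) :
    HasMatDeriv T E F' t :=
  fun i j => (hF i j).congr_of_mem (fun s hs => by rw [h s hs]) ht

end Calculus

/-! ### Continuity, bounds, and the unraveling identity. -/

lemma continuous_lindblad {n K : ℕ} (H : Matrix (Fin n) (Fin n) ℂ)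
    (L : Fin K → Matrix (Fin n) (Fin n) ℂ) : Continuous (lindblad H L) :=
  (lindbladLin H L).continuous_of_finiteDimensional

lemma exists_norm_mulVec_le {m n : ℕ} (C : Matrix (Fin m) (Fin n) ℂ) :
    ∃ c, 0 ≤ c ∧ ∀ y, ‖C *ᵥ y‖ ≤ c * ‖y‖ :=
  ⟨_, norm_nonneg _, (LinearMap.toContinuousLinearMap C.mulVecLin).le_opNorm⟩

lemma measurable_mulVec {m n : ℕ} (C : Matrix (Fin m) (Fin n) ℂ) :
    Measurable fun y : Fin n → ℂ => C *ᵥ y :=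
  (Continuous.matrix_mulVec continuous_const continuous_id).measurable

/-- The generator of any unraveling acts on xx† through 𝓛 alone; this is the source of independence
from the unraveling. -/
lemma IsUnraveling.generatorOuter_eq {n N K : ℕ} {T : ℝ} {H : Matrix (Fin n) (Fin n) ℂ}
    {L : Fin K → Matrix (Fin n) (Fin n) ℂ} {a : (Fin n → ℂ) → ℝ → Fin n → ℂ}
    {b : Fin N → (Fin n → ℂ) → ℝ → Fin n → ℂ} (hab : IsUnraveling T (lindblad H L) a b)
    {t : ℝ} (ht : t ∈ Icc 0 T) (x : Fin n → ℂ) :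
    generatorOuter (fun x => a x t) (fun j x => b j x t) x = lindbladLin H L (outer x) := by
  rw [SDLR.generatorOuter_eq]
  exact hab x t ht

/-! ### Second moments -/

section Moments

variable {Ω : Type*} {mΩ : MeasurableSpace Ω} {P : Measure Ω} {n d : ℕ}

lemma posSemidef_expect_outer {y : Ω → Fin d → ℂ} (hy : EntryIntegrable P fun ω => outer (y ω)) :
    (expect P fun ω => outer (y ω)).PosSemidef := by
  refine PosSemidef.of_dotProduct_mulVec_nonneg
    (expect_isHermitian fun ω => conjTranspose_outer (y ω)) fun x => ?_
  -- The quadratic form x†Cx becomes a 1 × 1 matrix linear in `C`, so the expectation passes through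
  -- it and leaves the mean of |x†y|².
  let S : Matrix (Fin 1) (Fin d) ℂ := Matrix.of fun _ => star x
  have h1 : ∀ C : Matrix (Fin d) (Fin d) ℂ, star x ⬝ᵥ (C *ᵥ x) = (sandwich S Sᴴ C) 0 0 := by
    intro C
    rw [sandwich_apply, Matrix.mul_assoc, Matrix.mul_apply]
    simp [S, dotProduct, mulVec, Matrix.mul_apply]
  rw [h1, ← expect_map hy]
  have h2 : ∀ ω, sandwich S Sᴴ (outer (y ω)) 0 0
      = ((Complex.normSq ((S *ᵥ y ω) 0) : ℝ) : ℂ) := fun ω => by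
    rw [sandwich_apply, ← outer_mulVec, outer, vecMulVec_apply, Pi.star_apply, Complex.star_def,
      Complex.mul_conj]
  simp only [expect, Matrix.of_apply, h2]
  rw [integral_complex_ofReal]
  exact_mod_cast integral_nonneg fun ω => Complex.normSq_nonneg _

lemma expect_outer_mulVec {y : Ω → Fin d → ℂ} (hy : EntryIntegrable P fun ω => outer (y ω))
    (C : Matrix (Fin n) (Fin d) ℂ) :
    expect P (fun ω => outer (C *ᵥ y ω)) = C * expect P (fun ω => outer (y ω)) * Cᴴ := by
  simp only [outer_mulVec]
  exact expect_map hy (sandwich C Cᴴ)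

end Moments

/-! ### Time derivative of the second moment. -/

section SecondMoment

variable {Ω : Type*} {mΩ : MeasurableSpace Ω} {P : Measure Ω} {ℱ : Filtration ℝ mΩ}
  {T : ℝ} {d M : ℕ} {A : (Fin d → ℂ) → ℝ → Fin d → ℂ}
  {B : Fin M → (Fin d → ℂ) → ℝ → Fin d → ℂ} {Y : ℝ → Ω → Fin d → ℂ}

/-- The integrated evolution equation of the components of `E[Y Y†]`. -/
lemma IsSDESolution.secondMoment_integral [IsProbabilityMeasure P]
    (h : IsSDESolution P ℱ T A B Y) (hT : 0 ≤ T)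
    (hgrowth : Integrable (fun p : ℝ × Ω => ‖A (Y p.1 p.2) p.1‖ * ‖Y p.1 p.2‖)
      ((volume.restrict (Icc 0 T)).prod P))
    (hsq : ∀ t ∈ Icc 0 T, Integrable (fun ω => ‖Y t ω‖ ^ 2) P)
    (hgen : ∀ t ∈ Icc 0 T, EntryIntegrable P fun ω =>
      generatorOuter (fun y => A y t) (fun j y => B j y t) (Y t ω))
    (φ : ℂ →L[ℝ] ℝ) (i j : Fin d) :
    IntegrableOn (fun u => φ (expect P (fun ω =>
      generatorOuter (fun y => A y u) (fun j y => B j y u) (Y u ω)) i j)) (Icc 0 T) ∧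
    ∀ t ∈ Icc 0 T, φ (secondMoment P Y t i j) - φ (secondMoment P Y 0 i j) =
      ∫ u in (0 : ℝ)..t, φ (expect P (fun ω =>
        generatorOuter (fun y => A y u) (fun j y => B j y u) (Y u ω)) i j) := by
  -- The martingale problem is stated for real functions; φ will be the real or the imaginary part.
  let β : (Fin d → ℂ) →L[ℝ] (Fin d → ℂ) →L[ℝ] ℝ :=
    (ContinuousLinearMap.compL ℝ (Fin d → ℂ) ℂ ℝ φ).comp (outerBilin i j)
  have hβ : ∀ x y, β x y = φ (outerBilin i j x y) := fun _ _ => rfl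
  have hgenβ : ∀ u y, generator (fun y => A y u) (fun j y => B j y u) (fun y => β y y) y
      = φ (generatorOuter (fun y => A y u) (fun j y => B j y u) y i j) := fun u y => by
    have h1 := generator_bilin_self (outerBilin i j) (fun y => A y u) (fun j y => B j y u) y
    have h2 : generatorOuter (fun y => A y u) (fun j y => B j y u) y i j
      = generator (fun y => A y u) (fun j y => B j y u) (fun y => outerBilin i j y y) y := rfl
    rw [h2, h1, generator_bilin_self]
    simp only [hβ, map_add, map_sum]
  have hexp : ∀ u ∈ Icc 0 T, ∫ ω, generator (fun y => A y u) (fun j y => B j y u)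
      (fun y => β y y) (Y u ω) ∂P = φ (expect P (fun ω =>
        generatorOuter (fun y => A y u) (fun j y => B j y u) (Y u ω)) i j) := fun u hu => by
    simp only [hgenβ]
    exact φ.integral_comp_comm (hgen u hu i j)
  have hmom : ∀ u ∈ Icc 0 T, ∫ ω, β (Y u ω) (Y u ω) ∂P = φ (secondMoment P Y u i j) :=
    fun u hu => φ.integral_comp_comm (entryIntegrable_outer (h.measurable hu) (hsq u hu) i j)
  obtain ⟨h1, h2⟩ := h.bilin_moment hT hgrowth hsq β
  refine ⟨h1.congr_fun hexp measurableSet_Icc, fun t ht => ?_⟩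
  rw [← hmom t ht, ← hmom 0 ⟨le_rfl, hT⟩, h2 t ht]
  refine intervalIntegral.integral_congr fun u hu => ?_
  rw [uIcc_of_le ht.1] at hu
  exact hexp u ⟨hu.1, hu.2.trans ht.2⟩

/-- If the expected generator depends continuously on the time, on `E[Y Y†]` and on a continuous
parameter, then it is the derivative of `E[Y Y†]`. -/
lemma IsSDESolution.hasMatDeriv_secondMoment [IsProbabilityMeasure P]
    (h : IsSDESolution P ℱ T A B Y) (hT : 0 ≤ T)
    (hgrowth : Integrable (fun p : ℝ × Ω => ‖A (Y p.1 p.2) p.1‖ * ‖Y p.1 p.2‖)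
      ((volume.restrict (Icc 0 T)).prod P))
    (hsq : ∀ t ∈ Icc 0 T, Integrable (fun ω => ‖Y t ω‖ ^ 2) P)
    (hgen : ∀ t ∈ Icc 0 T, EntryIntegrable P fun ω =>
      generatorOuter (fun y => A y t) (fun j y => B j y t) (Y t ω))
    (hcont : ContinuousOn (secondMoment P Y) (Icc 0 T) → ContinuousOn (fun u => expect P fun ω =>
      generatorOuter (fun y => A y u) (fun j y => B j y u) (Y u ω)) (Icc 0 T))
    {t : ℝ} (ht : t ∈ Icc 0 T) :
    HasMatDeriv T (secondMoment P Y) (expect P fun ω =>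
      generatorOuter (fun y => A y t) (fun j y => B j y t) (Y t ω)) t := by
  have key := h.secondMoment_integral hT hgrowth hsq hgen
  -- Continuity of E[YY†] comes from the integral equation alone; `hcont` then upgrades the
  -- integrand to a continuous one.
  have hσ : ContinuousOn (secondMoment P Y) (Icc 0 T) :=
    continuousOn_pi.2 fun i => continuousOn_pi.2 fun j => continuousOn_of_re_im
      (continuousOn_of_integral hT (key Complex.reCLM i j).1 (key Complex.reCLM i j).2)
      (continuousOn_of_integral hT (key Complex.imCLM i j).1 (key Complex.imCLM i j).2)
  intro i j
  have hη := continuousOn_pi.1 (continuousOn_pi.1 (hcont hσ) i) j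
  exact hasDerivWithinAt_of_re_im
    (hasDerivWithinAt_of_integral hT (Complex.continuous_re.comp_continuousOn hη)
      (key Complex.reCLM i j).2 ht)
    (hasDerivWithinAt_of_integral hT (Complex.continuous_im.comp_continuousOn hη)
      (key Complex.imCLM i j).2 ht)

end SecondMoment

/-! ### Low-rank dynamics of the SDLR method -/

section Dynamics

variable {Ω : Type*} {mΩ : MeasurableSpace Ω} {P : Measure Ω} {ℱ : Filtration ℝ mΩ}
  {T : ℝ} {n r N M K : ℕ} {H : Matrix (Fin n) (Fin n) ℂ} {L : Fin K → Matrix (Fin n) (Fin n) ℂ}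
  {a : (Fin n → ℂ) → ℝ → Fin n → ℂ} {b : Fin N → (Fin n → ℂ) → ℝ → Fin n → ℂ}
  {G : ℝ → Matrix (Fin n) (Fin n) ℂ}
  {A : (Fin r → ℂ) → ℝ → Fin r → ℂ} {B : Fin M → (Fin r → ℂ) → ℝ → Fin r → ℂ}
  {U : ℝ → Matrix (Fin n) (Fin r) ℂ} {Y : ℝ → Ω → Fin r → ℂ}

lemma secondMoment_isHermitian (P : Measure Ω) (Y : ℝ → Ω → Fin r → ℂ) (t : ℝ) :
    (secondMoment P Y t).IsHermitian :=
  expect_isHermitian fun ω => conjTranspose_outer (Y t ω)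

lemma expect_map_outer {y : Ω → Fin r → ℂ} (hy : Measurable y) :
    expect (P.map y) outer = expect P fun ω => outer (y ω) := by
  refine expect_map_measure hy.aemeasurable fun i j => Measurable.aestronglyMeasurable ?_
  exact (measurable_pi_apply i).mul (continuous_star.measurable.comp (measurable_pi_apply j))

lemma integrable_map_norm_sq {y : Ω → Fin r → ℂ} (hy : Measurable y)
    (h : Integrable (fun ω => ‖y ω‖ ^ 2) P) : Integrable (fun y => ‖y‖ ^ 2) (P.map y) :=
  (integrable_map_measure (by fun_prop) hy.aemeasurable).2 h

lemma IsAdmissible.expect_map_generatorOuter {V : Matrix (Fin n) (Fin r) ℂ} {y : Ω → Fin r → ℂ}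
    (hy : Measurable y) {g : Matrix (Fin n) (Fin n) ℂ} {α : (Fin r → ℂ) → Fin r → ℂ}
    {γ : Fin M → (Fin r → ℂ) → Fin r → ℂ} (h : IsAdmissible V (P.map y) g α γ) :
    expect (P.map y) (generatorOuter α γ) = expect P fun ω => generatorOuter α γ (y ω) :=
  expect_map_measure hy.aemeasurable fun i j => (h.entryIntegrable i j).aestronglyMeasurable

lemma lindblad_lowRank_isHermitian (hH : H.IsHermitian) (V : Matrix (Fin n) (Fin r) ℂ)
    {σ : Matrix (Fin r) (Fin r) ℂ} (hσ : σ.IsHermitian) : (lindblad H L (V * σ * Vᴴ)).IsHermitian :=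
  lindblad_isHermitian hH L (isHermitian_mul_mul_conjTranspose V hσ)

namespace IsSDLRDynamics

lemma entryIntegrable_generatorOuter (h : IsSDLRDynamics P ℱ T a b G A B U Y) {t : ℝ}
    (ht : t ∈ Icc 0 T) : EntryIntegrable P fun ω =>
      generatorOuter (fun y => A y t) (fun j y => B j y t) (Y t ω) := fun i j =>
  ((h.optimal t ht).1.entryIntegrable i j).comp_measurable (h.sde.measurable ht)

/-- The optimality condition of the SDLR method. -/
lemma tangentVector_eq (h : IsSDLRDynamics P ℱ T a b G A B U Y) (hH : H.IsHermitian)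
    (hab : IsUnraveling T (lindblad H L) a b) {t : ℝ} (ht : t ∈ Icc 0 T) :
    tangentVector (U t) (secondMoment P Y t) (G t)
      (expect P fun ω => generatorOuter (fun y => A y t) (fun j y => B j y t) (Y t ω)) =
    lindblad H L (U t * secondMoment P Y t * (U t)ᴴ) -
      projQ (U t) * lindblad H L (U t * secondMoment P Y t * (U t)ᴴ) * projQ (U t) := by
  have hY := h.sde.measurable ht
  have hσ : expect (P.map (Y t)) outer = secondMoment P Y t := expect_map_outer hY
  have hopt := (h.optimal t ht).tangentVector_eq (Λ := lindbladLin H L) (h.stiefel t ht)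
    (integrable_map_norm_sq hY (h.integrable_sq t ht)) (by rw [hσ]; exact h.invertible t ht)
    (hab.generatorOuter_eq ht)
    (by rw [hσ]; exact lindblad_lowRank_isHermitian hH _ (secondMoment_isHermitian P Y t))
  rwa [hσ, (h.optimal t ht).1.expect_map_generatorOuter hY] at hopt

/-- The block U†(·)U of the optimality condition, in which 𝒬ℓ𝒬 disappears. -/
lemma expect_generatorOuter (h : IsSDLRDynamics P ℱ T a b G A B U Y) (hH : H.IsHermitian)
    (hab : IsUnraveling T (lindblad H L) a b) {t : ℝ} (ht : t ∈ Icc 0 T) :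
    (expect P fun ω => generatorOuter (fun y => A y t) (fun j y => B j y t) (Y t ω)) =
      (U t)ᴴ * lindblad H L (U t * secondMoment P Y t * (U t)ᴴ) * U t := by
  have hU := h.stiefel t ht
  rw [← tangentVector_compress hU (σ := secondMoment P Y t) (h.optimal t ht).1.gauged
    (expect P fun ω => generatorOuter (fun y => A y t) (fun j y => B j y t) (Y t ω)),
    h.tangentVector_eq hH hab ht, Matrix.mul_sub, ← Matrix.mul_assoc, ← Matrix.mul_assoc,
    conjTranspose_mul_projQ hU, Matrix.zero_mul, Matrix.zero_mul, sub_zero]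

/-- The block 𝒬(·)U of the optimality condition; multiplied by σ⁻¹ it is the equation of motion for
`U`. -/
lemma gauge_mul (h : IsSDLRDynamics P ℱ T a b G A B U Y) (hH : H.IsHermitian)
    (hab : IsUnraveling T (lindblad H L) a b) {t : ℝ} (ht : t ∈ Icc 0 T) :
    Complex.I • (G t * U t) * secondMoment P Y t =
      projQ (U t) * lindblad H L (U t * secondMoment P Y t * (U t)ᴴ) * U t := by
  have hU := h.stiefel t ht
  rw [← tangentVector_projQ_mul hU (h.optimal t ht).1.gauged
    (expect P fun ω => generatorOuter (fun y => A y t) (fun j y => B j y t) (Y t ω)),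
    h.tangentVector_eq hH hab ht, Matrix.mul_sub, Matrix.sub_mul, Matrix.mul_assoc _ _ (U t),
    Matrix.mul_assoc _ _ (U t), Matrix.mul_assoc (projQ (U t) * _) _ (U t), projQ_mul hU,
    Matrix.mul_zero, Matrix.mul_zero, sub_zero, Matrix.mul_assoc]

lemma hasMatDeriv_secondMoment [IsProbabilityMeasure P]
    (h : IsSDLRDynamics P ℱ T a b G A B U Y) (hT : 0 ≤ T) (hH : H.IsHermitian)
    (hab : IsUnraveling T (lindblad H L) a b) {t : ℝ} (ht : t ∈ Icc 0 T) :
    HasMatDeriv T (secondMoment P Y)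
      ((U t)ᴴ * lindblad H L (U t * secondMoment P Y t * (U t)ᴴ) * U t) t := by
  rw [← h.expect_generatorOuter hH hab ht]
  refine h.sde.hasMatDeriv_secondMoment hT h.integrable_growth h.integrable_sq
    (fun t ht => h.entryIntegrable_generatorOuter ht) (fun hσ => ?_) ht
  have hU : ContinuousOn U (Icc 0 T) := HasMatDeriv.continuousOn h.ode
  have hUH : ContinuousOn (fun t => (U t)ᴴ) (Icc 0 T) :=
    (Continuous.matrix_conjTranspose continuous_id).comp_continuousOn hU
  have hmul : ∀ {k l m : ℕ} {F : ℝ → Matrix (Fin k) (Fin l) ℂ} {E : ℝ → Matrix (Fin l) (Fin m) ℂ},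
      ContinuousOn F (Icc 0 T) → ContinuousOn E (Icc 0 T) →
        ContinuousOn (fun t => F t * E t) (Icc 0 T) := fun hF hE =>
    (Continuous.matrix_mul continuous_fst continuous_snd).comp_continuousOn (hF.prodMk hE)
  -- Although `A` and `B` need not be continuous in time, optimality forces the expected generator
  -- to be U†𝓛(UσU†)U, which is continuous together with `U` and σ.
  refine (hmul (hmul hUH ((continuous_lindblad H L).comp_continuousOn
    (hmul (hmul hU hσ) hUH))) hU).congr fun u hu => ?_
  exact h.expect_generatorOuter hH hab hu

lemma posDef_secondMoment (h : IsSDLRDynamics P ℱ T a b G A B U Y) {t : ℝ} (ht : t ∈ Icc 0 T) :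
    (secondMoment P Y t).PosDef :=
  (posSemidef_expect_outer (entryIntegrable_outer (h.sde.measurable ht)
    (h.integrable_sq t ht))).posDef_iff_isUnit.2 (h.invertible t ht)

/-- The second moment of the SDLR dynamics solves the low-rank quantum master equation. -/
theorem isLowRankQME [IsProbabilityMeasure P]
    (h : IsSDLRDynamics P ℱ T a b G A B U Y) (hT : 0 ≤ T) (hH : H.IsHermitian)
    (hab : IsUnraveling T (lindblad H L) a b) :
    IsLowRankQME T (lindblad H L) U (secondMoment P Y) := by
  refine fun t ht => ⟨h.stiefel t ht, h.posDef_secondMoment ht,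
    h.hasMatDeriv_secondMoment hT hH hab ht, ?_⟩
  have hdet := (Matrix.isUnit_iff_isUnit_det _).1 (h.invertible t ht)
  rw [← h.gauge_mul hH hab ht, Matrix.mul_nonsing_inv_cancel_right _ _ hdet]
  exact h.ode t ht

/-- The second moment of `U Y` follows the dynamical low-rank approximation. -/
theorem isDLRApproximation [IsProbabilityMeasure P]
    (h : IsSDLRDynamics P ℱ T a b G A B U Y) (hT : 0 ≤ T) (hH : H.IsHermitian)
    (hab : IsUnraveling T (lindblad H L) a b) :
    IsDLRApproximation T (lindblad H L) U (secondMoment P Y)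
      (secondMoment P fun t ω => U t *ᵥ Y t ω) := by
  have hρ : ∀ t ∈ Icc 0 T, secondMoment P (fun t ω => U t *ᵥ Y t ω) t =
      U t * secondMoment P Y t * (U t)ᴴ := fun t ht =>
    expect_outer_mulVec (entryIntegrable_outer (h.sde.measurable ht) (h.integrable_sq t ht)) (U t)
  intro t ht
  have hU := h.stiefel t ht
  have hσ := secondMoment_isHermitian P Y t
  set η := (U t)ᴴ * lindblad H L (U t * secondMoment P Y t * (U t)ᴴ) * U t with hη
  have hgauged := (h.optimal t ht).1.gauged
  refine ⟨hU, h.posDef_secondMoment ht, hρ t ht,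
    tangentVector (U t) (secondMoment P Y t) (G t) η, ⟨G t, η, hgauged, ?_, rfl⟩, ?_, ?_⟩
  · rw [hη, ← h.expect_generatorOuter hH hab ht]
    exact expect_isHermitian fun ω => generatorOuter_isHermitian _ _ _
  -- The product rule for UσU† gives exactly the tangent vector with this `G` and η = σ'.
  · have hd := (((h.ode t ht).mul (h.hasMatDeriv_secondMoment hT hH hab ht)).mul
      (h.ode t ht).conjTranspose).congr ht hρ
    convert hd using 1
    rw [tangentVector, ← hη, conjTranspose_smul, conjTranspose_mul, hgauged.1.eq,
      Complex.star_def, Complex.conj_I, neg_smul, Matrix.mul_neg, Matrix.mul_smul, Matrix.add_mul,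
      Matrix.smul_mul, Matrix.smul_mul, ← sub_eq_add_neg]
    simp only [Matrix.mul_assoc]
  · rintro w ⟨G', η', -, -, rfl⟩
    have heq := h.tangentVector_eq hH hab ht
    rw [h.expect_generatorOuter hH hab ht] at heq
    rw [heq, hρ t ht]
    exact hsNorm_projQ_le hU _ (tangentVector_projQ hU _ G' η')

end IsSDLRDynamics

/-! ### The explicit system -/

/-- Compressing the coefficients by V† compresses the generator on xx†, because V†(Vy) = y. -/
lemma generatorOuter_pulled {V : Matrix (Fin n) (Fin r) ℂ} (α : (Fin n → ℂ) → Fin n → ℂ)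
    (γ : Fin N → (Fin n → ℂ) → Fin n → ℂ) (hV : Vᴴ * V = 1) (y : Fin r → ℂ) :
    generatorOuter (fun y => Vᴴ *ᵥ α (V *ᵥ y)) (fun j y => Vᴴ *ᵥ γ j (V *ᵥ y)) y =
      sandwich Vᴴ V (generatorOuter α γ (V *ᵥ y)) := by
  have hy : Vᴴ *ᵥ (V *ᵥ y) = y := by rw [mulVec_mulVec, hV, one_mulVec]
  have hy' : star y ᵥ* Vᴴ ᵥ* V = star y := by rw [vecMul_vecMul, hV, vecMul_one]
  simp only [generatorOuter_eq, sandwich_apply, outer_mulVec, Matrix.mul_add, Matrix.add_mul,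
    Matrix.mul_sum, Matrix.sum_mul, Matrix.mul_vecMulVec, vecMulVec_mul, hy, hy', star_mulVec,
    conjTranspose_conjTranspose]

lemma measurable_section {k : ℕ} {α : (Fin k → ℂ) → ℝ → Fin k → ℂ}
    (hα : Measurable fun p : (Fin k → ℂ) × Icc (0 : ℝ) T => α p.1 p.2) {t : ℝ}
    (ht : t ∈ Icc 0 T) : Measurable fun x => α x t :=
  hα.comp (measurable_id.prodMk (measurable_const (a := (⟨t, ht⟩ : Icc (0 : ℝ) T))))

namespace IsExplicitSDLR

lemma measurable_lift (h : IsExplicitSDLR P ℱ T a b U Y) {α : (Fin n → ℂ) → ℝ → Fin n → ℂ}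
    (hα : Measurable fun p : (Fin n → ℂ) × Icc (0 : ℝ) T => α p.1 p.2) {t : ℝ}
    (ht : t ∈ Icc 0 T) : Measurable fun ω => α (U t *ᵥ Y t ω) t :=
  (measurable_section hα ht).comp ((measurable_mulVec (U t)).comp (h.sde.measurable ht))

lemma entryIntegrable_drift (h : IsExplicitSDLR P ℱ T a b U Y)
    (ha : Measurable fun p : (Fin n → ℂ) × Icc (0 : ℝ) T => a p.1 p.2) {t : ℝ}
    (ht : t ∈ Icc 0 T) :
    EntryIntegrable P fun ω => vecMulVec (a (U t *ᵥ Y t ω) t) (star (Y t ω)) :=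
  entryIntegrable_vecMulVec (h.measurable_lift ha ht) (h.sde.measurable ht)
    (h.integrable_drift t ht)

lemma entryIntegrable_diffusion (h : IsExplicitSDLR P ℱ T a b U Y)
    (hb : ∀ j, Measurable fun p : (Fin n → ℂ) × Icc (0 : ℝ) T => b j p.1 p.2) {t : ℝ}
    (ht : t ∈ Icc 0 T) (j : Fin N) :
    EntryIntegrable P fun ω => outer (b j (U t *ᵥ Y t ω) t) :=
  entryIntegrable_outer (h.measurable_lift (hb j) ht) (h.integrable_diffusion j t ht)

/-- `a (U Y)†` as a linear function of `a Y†`. -/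
lemma vecMulVec_lift (V : Matrix (Fin n) (Fin r) ℂ) (x : Fin n → ℂ) (y : Fin r → ℂ) :
    vecMulVec x (star (V *ᵥ y)) = sandwich 1 Vᴴ (vecMulVec x (star y)) := by
  rw [sandwich_apply, Matrix.one_mul, vecMulVec_mul, star_mulVec]

lemma expect_drift (h : IsExplicitSDLR P ℱ T a b U Y)
    (ha : Measurable fun p : (Fin n → ℂ) × Icc (0 : ℝ) T => a p.1 p.2) {t : ℝ}
    (ht : t ∈ Icc 0 T) :
    expect P (fun ω => vecMulVec (a (U t *ᵥ Y t ω) t) (star (U t *ᵥ Y t ω))) =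
      expect P (fun ω => vecMulVec (a (U t *ᵥ Y t ω) t) (star (Y t ω))) * (U t)ᴴ := by
  simp only [vecMulVec_lift]
  rw [expect_map (h.entryIntegrable_drift ha ht), sandwich_apply, Matrix.one_mul]

lemma entryIntegrable_outer_lift (h : IsExplicitSDLR P ℱ T a b U Y) {t : ℝ}
    (ht : t ∈ Icc 0 T) : EntryIntegrable P fun ω => outer (U t *ᵥ Y t ω) := by
  simp only [outer_mulVec]
  exact (entryIntegrable_outer (h.sde.measurable ht) (h.integrable_sq t ht)).map
    (sandwich (U t) (U t)ᴴ)

lemma expect_generatorOuter_lift (h : IsExplicitSDLR P ℱ T a b U Y)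
    (hab : IsUnraveling T (lindblad H L) a b) {t : ℝ} (ht : t ∈ Icc 0 T) :
    expect P (fun ω => generatorOuter (fun x => a x t) (fun j x => b j x t) (U t *ᵥ Y t ω)) =
      lindblad H L (U t * secondMoment P Y t * (U t)ᴴ) := by
  simp only [hab.generatorOuter_eq ht]
  rw [expect_map (h.entryIntegrable_outer_lift ht), expect_outer_mulVec
    (entryIntegrable_outer (h.sde.measurable ht) (h.integrable_sq t ht))]
  rfl

/-- `𝓛(ρ_LR) = E[a X†] + E[a X†]† + ∑ j, E[b_j b_j†]`. -/
lemma lindblad_eq (h : IsExplicitSDLR P ℱ T a b U Y)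
    (ha : Measurable fun p : (Fin n → ℂ) × Icc (0 : ℝ) T => a p.1 p.2)
    (hb : ∀ j, Measurable fun p : (Fin n → ℂ) × Icc (0 : ℝ) T => b j p.1 p.2)
    (hab : IsUnraveling T (lindblad H L) a b) {t : ℝ} (ht : t ∈ Icc 0 T) :
    lindblad H L (U t * secondMoment P Y t * (U t)ᴴ) =
      expect P (fun ω => vecMulVec (a (U t *ᵥ Y t ω) t) (star (U t *ᵥ Y t ω))) +
      (expect P (fun ω => vecMulVec (a (U t *ᵥ Y t ω) t) (star (U t *ᵥ Y t ω))))ᴴ +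
      ∑ j, expect P fun ω => outer (b j (U t *ᵥ Y t ω) t) := by
  have h1 : EntryIntegrable P fun ω =>
      vecMulVec (a (U t *ᵥ Y t ω) t) (star (U t *ᵥ Y t ω)) := by
    simp only [vecMulVec_lift]
    exact (h.entryIntegrable_drift ha ht).map _
  have h2 : ∀ x y : Fin n → ℂ, vecMulVec y (star x) = (vecMulVec x (star y))ᴴ := fun x y => by
    rw [conjTranspose_vecMulVec, star_star]
  rw [← h.expect_generatorOuter_lift hab ht]
  simp only [generatorOuter_eq]
  simp only [h2 (a _ t)]
  rw [expect_add (h1.add h1.conjTranspose)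
      (EntryIntegrable.sum _ (h.entryIntegrable_diffusion hb ht)),
    expect_add h1 h1.conjTranspose, expect_sum _ (h.entryIntegrable_diffusion hb ht),
    expect_conjTranspose]

lemma gauge_mul (h : IsExplicitSDLR P ℱ T a b U Y) {t : ℝ} (ht : t ∈ Icc 0 T) :
    IsGauged (U t) (gauge P a b U Y t) ∧ Complex.I • (gauge P a b U Y t * U t) =
      projQ (U t) *
        (expect P (fun ω => vecMulVec (a (U t *ᵥ Y t ω) t) (star (U t *ᵥ Y t ω))) +
          ∑ j, expect P fun ω => outer (b j (U t *ᵥ Y t ω) t)) *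
        U t * (secondMoment P Y t)⁻¹ := by
  have h1 : gaugeHalf P a b U Y t = projQ (U t) *
      ((expect P (fun ω => vecMulVec (a (U t *ᵥ Y t ω) t) (star (U t *ᵥ Y t ω))) +
        ∑ j, expect P fun ω => outer (b j (U t *ᵥ Y t ω) t)) *
        U t * (secondMoment P Y t)⁻¹) * (U t)ᴴ := by
    simp only [gaugeHalf, Matrix.mul_assoc]
  rw [gauge, h1]
  refine ⟨isGauged_of_half (h.stiefel t ht) _, ?_⟩
  rw [half_mul (h.stiefel t ht)]
  simp only [Matrix.mul_assoc]

lemma isAdmissible (h : IsExplicitSDLR P ℱ T a b U Y)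
    (ha : Measurable fun p : (Fin n → ℂ) × Icc (0 : ℝ) T => a p.1 p.2)
    (hb : ∀ j, Measurable fun p : (Fin n → ℂ) × Icc (0 : ℝ) T => b j p.1 p.2) {t : ℝ}
    (ht : t ∈ Icc 0 T) :
    IsAdmissible (U t) (P.map (Y t)) (gauge P a b U Y t) (fun y => pulledDrift a U y t)
      (fun j y => pulledDiffusion b U j y t) := by
  have hY := h.sde.measurable ht
  have hm : ∀ {α : (Fin n → ℂ) → ℝ → Fin n → ℂ},
      (Measurable fun p : (Fin n → ℂ) × Icc (0 : ℝ) T => α p.1 p.2) →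
        Measurable fun y => (U t)ᴴ *ᵥ α (U t *ᵥ y) t := fun hα =>
    (measurable_mulVec (U t)ᴴ).comp ((measurable_section hα ht).comp (measurable_mulVec (U t)))
  obtain ⟨c, hc0, hc⟩ := exists_norm_mulVec_le (U t)ᴴ
  refine ⟨(h.gauge_mul ht).1, hm ha, fun j => hm (hb j), ?_, fun j => ?_⟩
  · have hma := ((hm ha).norm.mul measurable_norm)
    refine (integrable_map_measure hma.aestronglyMeasurable hY.aemeasurable).2 ?_
    refine ((h.integrable_drift t ht).const_mul c).mono' (hma.comp hY).aestronglyMeasurable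
      (ae_of_all _ fun ω => ?_)
    simp only [Function.comp_apply, norm_mul, norm_norm, ← mul_assoc, Pi.mul_apply]
    exact mul_le_mul_of_nonneg_right (hc _) (norm_nonneg _)
  · have hmb := ((hm (hb j)).norm.pow_const 2)
    refine (integrable_map_measure hmb.aestronglyMeasurable hY.aemeasurable).2 ?_
    refine ((h.integrable_diffusion j t ht).const_mul (c ^ 2)).mono'
      (hmb.comp hY).aestronglyMeasurable (ae_of_all _ fun ω => ?_)
    simp only [Function.comp_apply, norm_pow, norm_norm, ← mul_pow]
    exact pow_le_pow_left₀ (norm_nonneg _) (hc _) 2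

lemma expect_generatorOuter_pulled (h : IsExplicitSDLR P ℱ T a b U Y)
    (hab : IsUnraveling T (lindblad H L) a b) {t : ℝ} (ht : t ∈ Icc 0 T) :
    expect P (fun ω => generatorOuter (fun y => pulledDrift a U y t)
      (fun j y => pulledDiffusion b U j y t) (Y t ω)) =
      (U t)ᴴ * lindblad H L (U t * secondMoment P Y t * (U t)ᴴ) * U t := by
  have h1 : ∀ y, generatorOuter (fun y => pulledDrift a U y t)
      (fun j y => pulledDiffusion b U j y t) y = sandwich (U t)ᴴ (U t)
        (generatorOuter (fun x => a x t) (fun j x => b j x t) (U t *ᵥ y)) := fun y =>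
    generatorOuter_pulled (fun x => a x t) (fun j x => b j x t) (h.stiefel t ht) y
  have h2 : EntryIntegrable P fun ω =>
      generatorOuter (fun x => a x t) (fun j x => b j x t) (U t *ᵥ Y t ω) := by
    simp only [hab.generatorOuter_eq ht]
    exact (h.entryIntegrable_outer_lift ht).map _
  simp only [h1]
  rw [expect_map h2, h.expect_generatorOuter_lift hab ht, sandwich_apply]

/-- The explicit system is obtained by the SDLR method. -/
theorem isSDLRDynamics (h : IsExplicitSDLR P ℱ T a b U Y) (hH : H.IsHermitian)
    (ha : Measurable fun p : (Fin n → ℂ) × Icc (0 : ℝ) T => a p.1 p.2)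
    (hb : ∀ j, Measurable fun p : (Fin n → ℂ) × Icc (0 : ℝ) T => b j p.1 p.2)
    (hab : IsUnraveling T (lindblad H L) a b) :
    IsSDLRDynamics P ℱ T a b (gauge P a b U Y) (pulledDrift a U) (pulledDiffusion b U) U Y := by
  refine ⟨h.toIsLowRankTrajectory, fun t ht => ?_, h.sde, h.integrable_growth, fun t ht => ?_⟩
  · have hode := h.ode t ht
    -- E[a(UY)†]U = E[aY†]U†U = E[aY†], which reconciles the gauge formula with the ODE for `U`.
    rw [(h.gauge_mul ht).2, h.expect_drift ha ht, Matrix.mul_assoc (projQ (U t)) _ (U t),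
      Matrix.add_mul, Matrix.mul_assoc _ (U t)ᴴ, h.stiefel t ht, Matrix.mul_one]
    exact hode
  · have hU := h.stiefel t ht
    have hY := h.sde.measurable ht
    have hσ : expect (P.map (Y t)) outer = secondMoment P Y t := expect_map_outer hY
    have hadm := h.isAdmissible ha hb ht
    have hσh := secondMoment_isHermitian P Y t
    have hdet := (Matrix.isUnit_iff_isUnit_det _).1 (h.invertible t ht)
    refine hadm.isOptimal (Λ := lindbladLin H L) hU
      (integrable_map_norm_sq hY (h.integrable_sq t ht)) (hab.generatorOuter_eq ht) ?_
    rw [hadm.expect_map_generatorOuter hY, h.expect_generatorOuter_pulled hab ht, hσ]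
    refine SDLR.tangentVector_eq hσh (lindblad_lowRank_isHermitian hH _ hσh) hadm.gauged ?_
    -- The adjoint drift term E[Xa†] has range in that of `U`, hence is killed by 𝒬_U; this is why
    -- only E[aX†] and the diffusion terms appear in the gauge.
    have h0 : projQ (U t) * (expect P fun ω =>
        vecMulVec (a (U t *ᵥ Y t ω) t) (star (U t *ᵥ Y t ω)))ᴴ = 0 := by
      rw [h.expect_drift ha ht, conjTranspose_mul, conjTranspose_conjTranspose,
        ← Matrix.mul_assoc, projQ_mul hU, Matrix.zero_mul]
    rw [(h.gauge_mul ht).2, Matrix.nonsing_inv_mul_cancel_right _ _ hdet,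
      h.lindblad_eq ha hb hab ht, add_right_comm, Matrix.mul_add _ _ (_ᴴ), h0, add_zero]

end IsExplicitSDLR

end Dynamics

end SDLR

theorem mainTheorem4 {n r N K : ℕ} {T : ℝ} (hT : 0 < T)
    (H : Matrix (Fin n) (Fin n) ℂ) (hH : H.IsHermitian)
    (L : Fin K → Matrix (Fin n) (Fin n) ℂ)
    (a : (Fin n → ℂ) → ℝ → Fin n → ℂ) (b : Fin N → (Fin n → ℂ) → ℝ → Fin n → ℂ)
    (ha : Measurable fun p : (Fin n → ℂ) × Set.Icc (0 : ℝ) T => a p.1 p.2)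
    (hb : ∀ j, Measurable fun p : (Fin n → ℂ) × Set.Icc (0 : ℝ) T => b j p.1 p.2)
    (hab : SDLR.IsUnraveling T (SDLR.lindblad H L) a b)
    {Ω : Type*} {mΩ : MeasurableSpace Ω} (P : MeasureTheory.Measure Ω)
    [MeasureTheory.IsProbabilityMeasure P] (ℱ : MeasureTheory.Filtration ℝ mΩ)
    (U : ℝ → Matrix (Fin n) (Fin r) ℂ) (Y : ℝ → Ω → Fin r → ℂ) :
    -- the explicit coupled ODE-SDE system is a low-rank dynamics given by the SDLR method
    (SDLR.IsExplicitSDLR P ℱ T a b U Y →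
      SDLR.IsSDLRDynamics P ℱ T a b (SDLR.gauge P a b U Y)
        (SDLR.pulledDrift a U) (SDLR.pulledDiffusion b U) U Y) ∧
    -- every low-rank dynamics given by the SDLR method unravels the low-rank master equation
    (∀ (M : ℕ) (G : ℝ → Matrix (Fin n) (Fin n) ℂ)
        (A : (Fin r → ℂ) → ℝ → Fin r → ℂ) (B : Fin M → (Fin r → ℂ) → ℝ → Fin r → ℂ),
      SDLR.IsSDLRDynamics P ℱ T a b G A B U Y →
        SDLR.IsLowRankQME T (SDLR.lindblad H L) U (SDLR.secondMoment P Y) ∧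
        SDLR.IsDLRApproximation T (SDLR.lindblad H L) U (SDLR.secondMoment P Y)
          (SDLR.secondMoment P fun t ω => Matrix.mulVec (U t) (Y t ω))) := by
  refine ⟨fun h => h.isSDLRDynamics hH ha hb hab, fun M G A B h => ⟨?_, ?_⟩⟩
  · exact h.isLowRankQME hT.le hH hab
  · exact h.isDLRApproximation hT.le hH hab
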